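/- For $n\ge 0$ let $P(n)$ be the space of real symmetric positive definite $n\times n$ matrices, let $d_{P(n)}$ be the distance on it induced by the Riemannian metric $$\langle A,B\rangle_H=\operatorname{tr}(H^{-1}AH^{-1}B)\,\sqrt{\det H},\qquad H\in P(n),$$ with $A,B$ symmetric matrices, and let $\bar P(n)$ be the metric completion of $(P(n),d_{P(n)})$. Let $L^2([0,1],\bar P(n))$ be the set of square integrable maps $f$ from $[0,1]$ with Lebesgue measure to $\bar P(n)$ (that is, $\int_0^1 d(f(t),A)^2\,dt<\infty$ for some $A\in\bar P(n)$), modulo almost everywhere equality, with the distance $\left(\int_0^1 d(f(t),f'(t))^2\,dt\right)^{1/2}$. Let $M$ be a compact, orientable, smooth $n$-manifold (without boundary), and let $g_0$ be a smooth Riemannian metric on $M$ of total volume $1$, with volume measure $\mu_{g_0}$. For $p\in M$ let $d_p$ be the distance on the positive definite symmetric bilinear forms on $T_pM$ induced by the Riemannian metric $$\langle a,b\rangle_{h}=\operatorname{tr}(h^{-1}ah^{-1}b)\,\sqrt{\det(g_0(p)^{-1}h)} .$$ On the set $\mathcal E_{C^\infty}(M)$ of smooth Riemannian metrics on $M$ consider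 the $L^2$-distance $$d_{L^2}(g,h)=\left(\int_M d_p(g(p),h(p))^2\,d\mu_{g_0}(p)\right)^{1/2}.$$ Then the integrand is integrable for all $g,h$, $d_{L^2}$ is a metric on $\mathcal E_{C^\infty}(M)$, and the metric completion of $(\mathcal E_{C^\infty}(M),d_{L^2})$ is isometric to $L^2([0,1],\bar P(n))$. In particular it depends only on $n$: if $M'$ is another compact, orientable, smooth $n$-manifold, with a smooth Riemannian metric $g_0'$ of total volume $1$, then the completions of the spaces of Riemannian metrics on $M$ and on $M'$ with respect to their $L^2$-distances are isometric. -/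

import Mathlib

open scoped Manifold ContDiff
open MeasureTheory Set

noncomputable section

namespace EbinMetric

/-! ### The metric on positive definite matrices -/

/-- The scalar product `⟨A, B⟩_H = tr (H⁻¹ A H⁻¹ B) √(det (G⁻¹ H))` of two symmetric matrices
`A`, `B`, regarded as tangent vectors at the positive definite matrix `H`. Here `G` is a
positive definite reference matrix. -/
def innerAt {n : ℕ} (G H A B : Matrix (Fin n) (Fin n) ℝ) : ℝ :=
  (H⁻¹ * A * H⁻¹ * B).trace * √(G⁻¹ * H).det

/-- The entrywise derivative of a path of matrices. -/
def velocity {n : ℕ} (γ : ℝ → Matrix (Fin n) (Fin n) ℝ) (t : ℝ) : Matrix (Fin n) (Fin n) ℝ :=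
  Matrix.of fun i j => deriv (fun s => γ s i j) t

/-- The length of a path `γ` over `[0, 1]` for the Riemannian metric `innerAt G`. -/
def pathLength {n : ℕ} (G : Matrix (Fin n) (Fin n) ℝ) (γ : ℝ → Matrix (Fin n) (Fin n) ℝ) : ℝ :=
  ∫ t in (0 : ℝ)..1, √(innerAt G (γ t) (velocity γ t) (velocity γ t))

/-- `γ` is a `C¹` path from `H` to `K` which, for the times in `[0, 1]`, stays in the space of
positive definite symmetric matrices. (Every `C¹` path on `[0, 1]` is the restriction of one
defined on `ℝ`.) -/
structure IsPath {n : ℕ} (H K : Matrix (Fin n) (Fin n) ℝ)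
    (γ : ℝ → Matrix (Fin n) (Fin n) ℝ) : Prop where
  contDiff : ∀ i j, ContDiff ℝ 1 (fun t => γ t i j)
  posDef : ∀ t ∈ Icc (0 : ℝ) 1, (γ t).PosDef
  source : γ 0 = H
  target : γ 1 = K

/-- The Riemannian distance between two positive definite matrices for the Riemannian metric
`innerAt G`: the infimum of the lengths of the `C¹` paths joining them. -/
def matrixDist {n : ℕ} (G H K : Matrix (Fin n) (Fin n) ℝ) : ℝ :=
  sInf {L | ∃ γ, IsPath H K γ ∧ L = pathLength G γ}

section Helpers

variable {n : ℕ} {G H K L : Matrix (Fin n) (Fin n) ℝ} {γ γ₁ γ₂ : ℝ → Matrix (Fin n) (Fin n) ℝ}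

lemma pathLength_nonneg : 0 ≤ pathLength G γ :=
  intervalIntegral.integral_nonneg zero_le_one fun _ _ => Real.sqrt_nonneg _

lemma matrixDist_nonneg : 0 ≤ matrixDist G H K := by
  apply Real.sInf_nonneg
  rintro _ ⟨γ, -, rfl⟩
  exact pathLength_nonneg

lemma matrixDist_le (h : IsPath H K γ) : matrixDist G H K ≤ pathLength G γ := by
  have hb : BddBelow {L | ∃ γ, IsPath H K γ ∧ L = pathLength G γ} := by
    refine ⟨0, ?_⟩
    rintro _ ⟨γ, -, rfl⟩
    exact pathLength_nonneg
  exact csInf_le hb ⟨γ, h, rfl⟩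

lemma exists_isPath (hH : H.PosDef) (hK : K.PosDef) : ∃ γ, IsPath H K γ := by
  refine ⟨fun t => (1 - t) • H + t • K, ?_, ?_, by simp, by simp⟩
  · intro i j
    simp only [Matrix.add_apply, Matrix.smul_apply, smul_eq_mul]
    fun_prop
  · rintro t ⟨h0, h1⟩
    rcases h0.eq_or_lt with rfl | h0
    · simpa using hH
    · exact Matrix.PosDef.posSemidef_add (hH.posSemidef.smul (by linarith)) (hK.smul h0)

lemma exists_isPath_lt (hH : H.PosDef) (hK : K.PosDef) {r : ℝ} (hr : matrixDist G H K < r) :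
    ∃ γ, IsPath H K γ ∧ pathLength G γ < r := by
  obtain ⟨γ, hγ⟩ := exists_isPath hH hK
  have hne : {L | ∃ γ, IsPath H K γ ∧ L = pathLength G γ}.Nonempty := ⟨pathLength G γ, γ, hγ, rfl⟩
  obtain ⟨_, ⟨γ', h, rfl⟩, h'⟩ := exists_lt_of_csInf_lt hne hr
  exact ⟨γ', h, h'⟩

lemma matrixDist_self (hH : H.PosDef) : matrixDist G H H = 0 := by
  refine le_antisymm ?_ matrixDist_nonneg
  have h : IsPath H H (fun _ => H) := ⟨fun _ _ => contDiff_const, fun _ _ => hH, rfl, rfl⟩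
  refine (matrixDist_le (G := G) h).trans_eq ?_
  have : velocity (fun _ : ℝ => H) = 0 := by
    ext t i j
    simp [velocity]
  simp [pathLength, this, innerAt]

lemma innerAt_smul (c : ℝ) (A : Matrix (Fin n) (Fin n) ℝ) :
    √(innerAt G H (c • A) (c • A)) = √(innerAt G H A A) * |c| := by
  rw [← Real.sqrt_sq_eq_abs, ← Real.sqrt_mul' _ (sq_nonneg c)]
  congr 1
  simp only [innerAt, Matrix.mul_smul, Matrix.smul_mul, Matrix.trace_smul, smul_eq_mul]
  ring

lemma velocity_comp (hγ : ∀ i j, ContDiff ℝ 1 (fun t => γ t i j)) {u : ℝ → ℝ} {u' t : ℝ}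
    (hu : HasDerivAt u u' t) : velocity (fun s => γ (u s)) t = u' • velocity γ (u t) := by
  ext i j
  have h1 : HasDerivAt (fun s => γ s i j) (deriv (fun s => γ s i j) (u t)) (u t) :=
    ((hγ i j).differentiable one_ne_zero _).hasDerivAt
  have h2 := (h1.comp t hu).deriv
  simp only [velocity, Matrix.of_apply, Matrix.smul_apply, smul_eq_mul]
  rw [mul_comm]
  exact h2

lemma IsPath.symm (h : IsPath H K γ) : IsPath K H (fun t => γ (1 - t)) := by
  refine ⟨fun i j => (h.contDiff i j).comp (by fun_prop), fun t ht => h.posDef _ ?_, ?_, ?_⟩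
  · exact ⟨by linarith [ht.2], by linarith [ht.1]⟩
  · simpa using h.target
  · simpa using h.source

lemma pathLength_symm (h : IsPath H K γ) : pathLength G (fun t => γ (1 - t)) = pathLength G γ := by
  have key : ∀ t : ℝ, √(innerAt G (γ (1 - t)) (velocity (fun t => γ (1 - t)) t)
      (velocity (fun t => γ (1 - t)) t))
      = √(innerAt G (γ (1 - t)) (velocity γ (1 - t)) (velocity γ (1 - t))) := by
    intro t
    have hu : HasDerivAt (fun s : ℝ => 1 - s) (-1) t := by
      simpa using (hasDerivAt_id t).const_sub 1
    rw [velocity_comp h.contDiff hu, innerAt_smul]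
    simp
  simp only [pathLength, key]
  have := intervalIntegral.integral_comp_sub_left (a := 0) (b := 1)
    (fun t => √(innerAt G (γ t) (velocity γ t) (velocity γ t))) 1
  simpa using this

lemma matrixDist_comm (hH : H.PosDef) (hK : K.PosDef) : matrixDist G H K = matrixDist G K H := by
  have key : ∀ {H K : Matrix (Fin n) (Fin n) ℝ}, H.PosDef → K.PosDef →
      matrixDist G H K ≤ matrixDist G K H := by
    intro H K hH hK
    refine le_of_forall_gt fun r hr => ?_
    obtain ⟨γ, hγ, hr⟩ := exists_isPath_lt hK hH hr
    exact (matrixDist_le hγ.symm).trans_lt ((pathLength_symm hγ).trans_lt hr)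
  exact le_antisymm (key hH hK) (key hK hH)

lemma continuous_velocity (h : ∀ i j, ContDiff ℝ 1 (fun t => γ t i j)) :
    Continuous (velocity γ) :=
  continuous_matrix fun i j => (h i j).continuous_deriv le_rfl

lemma continuousOn_speed (h : IsPath H K γ) :
    ContinuousOn (fun t => √(innerAt G (γ t) (velocity γ t) (velocity γ t))) (Icc 0 1) := by
  have hγ : Continuous γ := continuous_matrix fun i j => (h.contDiff i j).continuous
  have hv := continuous_velocity h.contDiff
  intro t ht
  apply ContinuousAt.continuousWithinAt
  have hdet : (γ t).det ≠ 0 := (h.posDef t ht).det_pos.ne'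
  have hinv : ContinuousAt (fun s => (γ s)⁻¹) t := by
    refine ContinuousAt.comp (g := fun A : Matrix (Fin n) (Fin n) ℝ => A⁻¹) ?_ hγ.continuousAt
    refine continuousAt_matrix_inv _ ?_
    rw [Ring.inverse_eq_inv']
    exact continuousAt_inv₀ hdet
  have h1 : ContinuousAt (fun s => ((γ s)⁻¹ * velocity γ s * (γ s)⁻¹ * velocity γ s).trace) t :=
    (Continuous.matrix_trace continuous_id).continuousAt.comp
      (((hinv.mul hv.continuousAt).mul hinv).mul hv.continuousAt)
  have h2 : Continuous (fun s => √(G⁻¹ * γ s).det) :=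
    ((continuous_const.matrix_mul hγ).matrix_det).sqrt
  exact (h1.mul h2.continuousAt).sqrt

lemma matrixDist_triangle (hH : H.PosDef) (hK : K.PosDef) (hL : L.PosDef) :
    matrixDist G H L ≤ matrixDist G H K + matrixDist G K L := by
  refine le_of_forall_pos_lt_add fun ε hε => ?_
  obtain ⟨γ₁, h₁, hr₁⟩ := exists_isPath_lt (G := G) hH hK
    (lt_add_of_pos_right (matrixDist G H K) (half_pos hε))
  obtain ⟨γ₂, h₂, hr₂⟩ := exists_isPath_lt (G := G) hK hL
    (lt_add_of_pos_right (matrixDist G K L) (half_pos hε))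
  -- reparametrize so as to stop at the junction point, and concatenate
  set u : ℝ → ℝ := fun t => Real.smoothTransition (2 * t) with hu
  set v : ℝ → ℝ := fun t => Real.smoothTransition (2 * t - 1) with hv
  have cu : ContDiff ℝ 1 u := (Real.smoothTransition.contDiff (n := 1)).comp (by fun_prop)
  have cv : ContDiff ℝ 1 v := (Real.smoothTransition.contDiff (n := 1)).comp (by fun_prop)
  have mu : Monotone u := fun a b hab => Real.smoothTransition.monotone (by linarith)
  have mv : Monotone v := fun a b hab => Real.smoothTransition.monotone (by linarith)
  have u1 : ∀ t, 1 / 2 ≤ t → u t = 1 := fun t ht =>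
    Real.smoothTransition.one_of_one_le (by linarith)
  have v0 : ∀ t, t ≤ 1 / 2 → v t = 0 := fun t ht =>
    Real.smoothTransition.zero_of_nonpos (by linarith)
  have u0 : u 0 = 0 := by simp [hu]
  have v1 : v 1 = 1 := Real.smoothTransition.one_of_one_le (by norm_num)
  have iu : ∀ t, u t ∈ Icc (0 : ℝ) 1 := fun t =>
    ⟨Real.smoothTransition.nonneg _, Real.smoothTransition.le_one _⟩
  have iv : ∀ t, v t ∈ Icc (0 : ℝ) 1 := fun t =>
    ⟨Real.smoothTransition.nonneg _, Real.smoothTransition.le_one _⟩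
  set γ : ℝ → Matrix (Fin n) (Fin n) ℝ := fun t => γ₁ (u t) + γ₂ (v t) - K with hγ
  have e1 : ∀ t, t ≤ 1 / 2 → γ t = γ₁ (u t) := fun t ht => by
    simp [hγ, v0 t ht, h₂.source]
  have e2 : ∀ t, 1 / 2 ≤ t → γ t = γ₂ (v t) := fun t ht => by
    simp [hγ, u1 t ht, h₁.target]
  have hp : IsPath H L γ := by
    refine ⟨fun i j => ?_, fun t _ => ?_, ?_, ?_⟩
    · exact (((h₁.contDiff i j).comp cu).add ((h₂.contDiff i j).comp cv)).sub contDiff_const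
    · rcases le_total t (1 / 2) with ht | ht
      · rw [e1 t ht]; exact h₁.posDef _ (iu t)
      · rw [e2 t ht]; exact h₂.posDef _ (iv t)
    · rw [e1 0 (by norm_num), u0, h₁.source]
    · rw [e2 1 (by norm_num), v1, h₂.target]
  have vel_congr : ∀ {α β : ℝ → Matrix (Fin n) (Fin n) ℝ} {t : ℝ} {s : Set ℝ}, s ∈ nhds t →
      (∀ r ∈ s, α r = β r) → velocity α t = velocity β t := by
    intro α β t s hs h
    ext i j
    simp only [velocity, Matrix.of_apply]
    apply Filter.EventuallyEq.deriv_eq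
    filter_upwards [hs] with r hr
    rw [h r hr]
  have hc := continuousOn_speed (G := G) hp
  have split : pathLength G γ
      = (∫ t in (0 : ℝ)..(1 / 2), √(innerAt G (γ t) (velocity γ t) (velocity γ t)))
        + ∫ t in (1 / 2 : ℝ)..1, √(innerAt G (γ t) (velocity γ t) (velocity γ t)) := by
    rw [pathLength, intervalIntegral.integral_add_adjacent_intervals]
    · apply ContinuousOn.intervalIntegrable
      rw [uIcc_of_le (by norm_num)]
      exact hc.mono (Icc_subset_Icc le_rfl (by norm_num))
    · apply ContinuousOn.intervalIntegrable
      rw [uIcc_of_le (by norm_num)]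
      exact hc.mono (Icc_subset_Icc (by norm_num) le_rfl)
  have part : ∀ {w : ℝ → ℝ} {δ : ℝ → Matrix (Fin n) (Fin n) ℝ} {a b : ℝ}, a ≤ b →
      ContDiff ℝ 1 w → Monotone w → w a = 0 → w b = 1 →
      (∀ i j, ContDiff ℝ 1 (fun t => δ t i j)) → (∀ t ∈ Ioo a b, γ t = δ (w t)) →
      (∫ t in a..b, √(innerAt G (γ t) (velocity γ t) (velocity γ t))) = pathLength G δ := by
    intro w δ a b hab cw mw wa wb hδ heq
    have hd : ∀ t, HasDerivAt w (deriv w t) t := fun t =>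
      (cw.differentiable one_ne_zero t).hasDerivAt
    have := intervalIntegral.integral_comp_mul_deriv_of_deriv_nonneg (a := a) (b := b)
      (g := fun t => √(innerAt G (δ t) (velocity δ t) (velocity δ t)))
      cw.continuous.continuousOn (fun t _ => hd t) (fun t _ => mw.deriv_nonneg)
    rw [wa, wb] at this
    rw [pathLength, ← this]
    rw [intervalIntegral.integral_of_le hab, intervalIntegral.integral_of_le hab,
      integral_Ioc_eq_integral_Ioo, integral_Ioc_eq_integral_Ioo]
    refine setIntegral_congr_fun measurableSet_Ioo fun t ht => ?_
    simp only [Function.comp_apply]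
    rw [vel_congr (Ioo_mem_nhds ht.1 ht.2) heq, heq t ht, velocity_comp hδ (hd t), innerAt_smul,
      abs_of_nonneg mw.deriv_nonneg]
  have p1 := part (δ := γ₁) (a := 0) (b := 1 / 2) (by norm_num) cu mu u0 (u1 _ le_rfl)
    h₁.contDiff (fun t ht => e1 t ht.2.le)
  have p2 := part (δ := γ₂) (a := 1 / 2) (b := 1) (by norm_num) cv mv (v0 _ le_rfl) v1
    h₂.contDiff (fun t ht => e2 t ht.1.le)
  have := matrixDist_le (G := G) hp
  rw [split, p1, p2] at this
  linarith

end Helpers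

/-- The space `P(n)` of real symmetric positive definite `n × n` matrices. -/
structure PosDefMatrix (n : ℕ) where
  toMatrix : Matrix (Fin n) (Fin n) ℝ
  posDef : toMatrix.PosDef

/-- `P(n)` carries the distance `d_{P(n)}` induced by the Riemannian metric
`⟨A, B⟩_H = tr (H⁻¹ A H⁻¹ B) √(det H)`. -/
instance (n : ℕ) : PseudoMetricSpace (PosDefMatrix n) where
  dist H K := matrixDist 1 H.toMatrix K.toMatrix
  dist_self H := matrixDist_self H.posDef
  dist_comm H K := matrixDist_comm H.posDef K.posDef
  dist_triangle H K L := matrixDist_triangle H.posDef K.posDef L.posDef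

/-- The metric completion of `P(n)`. -/
abbrev PBar (n : ℕ) : Type := UniformSpace.Completion (PosDefMatrix n)

/-! ### Square integrable maps into a metric space -/

/-- The space `L²(Ω, X)` of square integrable maps from a finite measure space to a metric space,
up to almost everywhere equality. -/
def L2Map {Ω : Type*} [MeasurableSpace Ω] (μ : Measure Ω) (X : Type*) [MetricSpace X] : Type _ :=
  {f : Ω →ₘ[μ] X // ∃ A : X, Integrable (fun p => dist (f p) A ^ 2) μ}

section L2Helpers

variable {Ω : Type*} [MeasurableSpace Ω] {μ : Measure Ω} {X : Type*} [MetricSpace X]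

lemma sqrt_integral_sq {h : Ω → ℝ} (hh : MemLp h 2 μ) :
    √(∫ p, h p ^ 2 ∂μ) = (eLpNorm h 2 μ).toReal := by
  rw [hh.eLpNorm_eq_integral_rpow_norm (by norm_num) (by norm_num),
    ENNReal.toReal_ofReal (by positivity), Real.sqrt_eq_rpow]
  simp

lemma memLp_dist [IsFiniteMeasure μ] (f g : L2Map μ X) :
    MemLp (fun p => dist (f.1 p) (g.1 p)) 2 μ := by
  obtain ⟨A, hA⟩ := f.2
  obtain ⟨B, hB⟩ := g.2
  have mf := f.1.aestronglyMeasurable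
  have mg := g.1.aestronglyMeasurable
  have h1 : MemLp (fun p => dist (f.1 p) A) 2 μ :=
    (memLp_two_iff_integrable_sq (mf.dist aestronglyMeasurable_const)).2 hA
  have h2 : MemLp (fun p => dist (g.1 p) B) 2 μ :=
    (memLp_two_iff_integrable_sq (mg.dist aestronglyMeasurable_const)).2 hB
  refine ((h1.add (memLp_const (dist A B))).add h2).mono (mf.dist mg)
    (Filter.Eventually.of_forall fun p => ?_)
  simp only [Pi.add_apply, Real.norm_eq_abs]
  rw [abs_of_nonneg (by positivity), abs_of_nonneg (by positivity)]
  have := dist_triangle4 (f.1 p) A B (g.1 p)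
  rwa [dist_comm B] at this

lemma sqrt_integral_dist_triangle [IsFiniteMeasure μ] (f g h : L2Map μ X) :
    √(∫ p, dist (f.1 p) (h.1 p) ^ 2 ∂μ)
      ≤ √(∫ p, dist (f.1 p) (g.1 p) ^ 2 ∂μ) + √(∫ p, dist (g.1 p) (h.1 p) ^ 2 ∂μ) := by
  have h1 := memLp_dist f g
  have h2 := memLp_dist g h
  have h3 := memLp_dist f h
  rw [sqrt_integral_sq h1, sqrt_integral_sq h2, sqrt_integral_sq h3,
    ← ENNReal.toReal_add h1.2.ne h2.2.ne]
  refine ENNReal.toReal_mono (ENNReal.add_ne_top.2 ⟨h1.2.ne, h2.2.ne⟩) ?_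
  refine le_trans (eLpNorm_mono_real (g := (fun p => dist (f.1 p) (g.1 p)) +
    fun p => dist (g.1 p) (h.1 p)) fun p => ?_) (eLpNorm_add_le h1.1 h2.1 one_le_two)
  rw [Real.norm_eq_abs, abs_of_nonneg dist_nonneg]
  exact dist_triangle _ _ _

lemma eq_of_sqrt_integral_dist [IsFiniteMeasure μ] (f g : L2Map μ X)
    (h : √(∫ p, dist (f.1 p) (g.1 p) ^ 2 ∂μ) = 0) : f = g := by
  have h1 := memLp_dist f g
  rw [sqrt_integral_sq h1, ENNReal.toReal_eq_zero_iff, or_iff_left h1.2.ne,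
    eLpNorm_eq_zero_iff h1.1 two_ne_zero] at h
  refine Subtype.ext (AEEqFun.ext ?_)
  filter_upwards [h] with p hp
  exact dist_eq_zero.1 hp

end L2Helpers

/-- `L²(Ω, X)` carries the distance `d(f, g) = (∫ d_X(f, g)² dμ)^{1/2}`. -/
instance {Ω : Type*} [MeasurableSpace Ω] (μ : Measure Ω) [IsFiniteMeasure μ]
    (X : Type*) [MetricSpace X] : MetricSpace (L2Map μ X) where
  dist f g := √(∫ p, dist (f.1 p) (g.1 p) ^ 2 ∂μ)
  dist_self f := by simp
  dist_comm f g := by simp [dist_comm]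
  dist_triangle f g h := sqrt_integral_dist_triangle f g h
  eq_of_dist_eq_zero {f g} h := eq_of_sqrt_integral_dist f g h

/-! ### Riemannian metrics on a manifold -/

section Manifold

variable (n : ℕ) (M : Type*) [TopologicalSpace M] [ChartedSpace (EuclideanSpace ℝ (Fin n)) M]

/-- `M` is orientable: it is covered by smooth charts all of whose coordinate changes have
positive Jacobian determinant. -/
def IsOrientable : Prop :=
  ∃ A : Set (OpenPartialHomeomorph M (EuclideanSpace ℝ (Fin n))),
    A ⊆ IsManifold.maximalAtlas (𝓡 n) ∞ M ∧
    (∀ p : M, ∃ e ∈ A, p ∈ e.source) ∧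
    ∀ e ∈ A, ∀ e' ∈ A, ∀ x ∈ (e.symm.trans e').source,
      0 < (fderiv ℝ (fun y => e' (e.symm y)) x).det

/-- The space of smooth Riemannian metrics on `M`. -/
abbrev RiemMetric [IsManifold (𝓡 n) ∞ M] : Type _ :=
  Bundle.ContMDiffRiemannianMetric (𝓡 n) ∞ (EuclideanSpace ℝ (Fin n))
    (fun p : M => TangentSpace (𝓡 n) p)

variable {n M} [IsManifold (𝓡 n) ∞ M]

/-- The Gram matrix of `g` at `x` in the coordinates given by the chart `e`: its entries are
`g (∂ᵢ, ∂ⱼ)`, where the `∂ᵢ` are the coordinate vector fields of the chart. -/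
def gramInChart (g : RiemMetric n M) (e : OpenPartialHomeomorph M (EuclideanSpace ℝ (Fin n)))
    (x : EuclideanSpace ℝ (Fin n)) : Matrix (Fin n) (Fin n) ℝ :=
  Matrix.of fun i j => g.inner (e.symm x)
    (mfderiv (𝓡 n) (𝓡 n) e.symm x (EuclideanSpace.single i (1 : ℝ)))
    (mfderiv (𝓡 n) (𝓡 n) e.symm x (EuclideanSpace.single j (1 : ℝ)))

/-- The measure on `M` which is carried by the domain of the chart `e` and has there the density
`√(det gᵢⱼ)` with respect to Lebesgue measure in the coordinates. -/
def chartVolume [MeasurableSpace M] (g : RiemMetric n M)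
    (e : OpenPartialHomeomorph M (EuclideanSpace ℝ (Fin n))) : Measure M :=
  Measure.map e.symm ((volume.restrict e.target).withDensity
    fun x => ENNReal.ofReal √(gramInChart g e x).det)

/-- The Riemannian volume measure `μ_g`. The measures `chartVolume` of the various charts are
the restrictions of `μ_g` to the chart domains; `μ_g` is obtained by gluing them, that is, it is
their supremum in the lattice of measures. -/
def volumeMeasure [MeasurableSpace M] (g : RiemMetric n M) : Measure M :=
  ⨆ p : M, chartVolume g (chartAt (EuclideanSpace ℝ (Fin n)) p)

/-- The matrix of the scalar product `g p` in a basis of the tangent space at `p`. (As a vector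
space, `TangentSpace (𝓡 n) p` is `EuclideanSpace ℝ (Fin n)`, and its canonical basis is used.) -/
def gramAt (g : RiemMetric n M) (p : M) : Matrix (Fin n) (Fin n) ℝ :=
  Matrix.of fun i j => g.inner p
    (EuclideanSpace.single i (1 : ℝ) : EuclideanSpace ℝ (Fin n))
    (EuclideanSpace.single j (1 : ℝ) : EuclideanSpace ℝ (Fin n))

/-- The distance `d_p` between the values of `g` and `h` at `p`, induced by the Riemannian metric
`⟨a, b⟩_h = tr (h⁻¹ a h⁻¹ b) √(det (g₀(p)⁻¹ h))` on the positive definite symmetric bilinear forms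
on the tangent space at `p`. Traces and determinants of these endomorphisms, hence also `d_p`, do
not depend on the basis in which they are computed. -/
def fiberDist (g₀ : RiemMetric n M) (p : M) (g h : RiemMetric n M) : ℝ :=
  matrixDist (gramAt g₀ p) (gramAt g p) (gramAt h p)

/-- The `L²`-distance `d_{L²}(g, h) = (∫_M d_p(g(p), h(p))² dμ_{g₀}(p))^{1/2}` between two
Riemannian metrics. -/
def L2Dist [MeasurableSpace M] (g₀ g h : RiemMetric n M) : ℝ :=
  √(∫ p, fiberDist g₀ p g h ^ 2 ∂volumeMeasure g₀)

end Manifold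

end EbinMetric

end

noncomputable section

namespace EbinMetric

/-! ### Distances between positive definite matrices -/

section Matrices

variable {n : ℕ} {G H K C : Matrix (Fin n) (Fin n) ℝ} {γ : ℝ → Matrix (Fin n) (Fin n) ℝ}

/-! The fibre distance does not see the basis: a congruence by an invertible matrix, applied also to
the reference matrix, is an isometry (`matrixDist_congr`). In a `g₀`-orthonormal frame every fibre
therefore looks like `P(n)` with reference matrix 1. Such frames need not exist continuously on all
of `M`, but they exist measurably: countably many chart frames are patched together
(`ChartSelection`) and orthonormalized by `invSqrt`. A Riemannian metric becomes a measurable map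
from `M` to `PBar n`, and `toL2` carries `L2Dist` to the distance of `L²(M, PBar n)`.

Three facts then determine the completion. `toL2` is injective, because the distance on `P(n)` is
definite (`eq_of_matrixDist_one_eq_zero`) and nonempty open sets have positive volume. The target is
complete: the Kuratowski embedding puts it inside a Bochner `L²` space. The image is dense
(`denseRange_toL2`): smooth metrics realize a dense set of values at every point, and a smooth
cutoff glues two of them along any measurable set with a small error, since the fibre distances
involved are bounded uniformly in the cutoff (`exists_fiberDist_interpolate_le`).

Finally `M` with its volume is a standard Borel probability space, without atoms if `n ≠ 0`, hence
isomorphic modulo null sets to the unit interval through distribution and quantile functions. For `n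
= 0` both `L²` spaces are points. Nothing in the model space remembers `M`. -/

lemma posDef_congr (hH : H.PosDef) (hC : IsUnit C.det) : (C.transpose * H * C).PosDef := by
  have hC' : IsUnit C := (Matrix.isUnit_iff_isUnit_det C).2 hC
  have := (Matrix.IsUnit.posDef_star_left_conjugate_iff (x := H) hC').2 hH
  rwa [Matrix.star_eq_conjTranspose, Matrix.conjTranspose_eq_transpose_of_trivial] at this

lemma velocity_congr (hγ : ∀ i j, ContDiff ℝ 1 (fun t => γ t i j))
    (A B : Matrix (Fin n) (Fin n) ℝ) (t : ℝ) :
    velocity (fun s => A * γ s * B) t = A * velocity γ t * B := by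
  ext i j
  have h1 : ∀ i j, HasDerivAt (fun s => γ s i j) (velocity γ t i j) t := fun i j =>
    ((hγ i j).differentiable one_ne_zero _).hasDerivAt
  simp only [velocity, Matrix.of_apply]
  refine HasDerivAt.deriv ?_
  simp only [Matrix.mul_apply]
  refine HasDerivAt.fun_sum fun k _ => HasDerivAt.mul_const ?_ _
  exact HasDerivAt.fun_sum fun l _ => HasDerivAt.const_mul _ (h1 _ _)

/-- Congruence of `X` and `Y` by `C` conjugates `X⁻¹ * Y` by `C`, and traces and determinants are
invariant under conjugation. -/
lemma innerAt_congr (hC : IsUnit C.det) (A B : Matrix (Fin n) (Fin n) ℝ) :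
    innerAt (C.transpose * G * C) (C.transpose * H * C) (C.transpose * A * C)
      (C.transpose * B * C) = innerAt G H A B := by
  have hC' : IsUnit C.transpose.det := by rwa [Matrix.det_transpose]
  have e1 : ∀ X : Matrix (Fin n) (Fin n) ℝ, (C.transpose * X * C)⁻¹
      = C⁻¹ * X⁻¹ * C.transpose⁻¹ := fun X => by
    rw [Matrix.mul_inv_rev, Matrix.mul_inv_rev, Matrix.mul_assoc]
  have e2 : ∀ X Y : Matrix (Fin n) (Fin n) ℝ,
      (C.transpose * X * C)⁻¹ * (C.transpose * Y * C) = C⁻¹ * (X⁻¹ * Y) * C := fun X Y => by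
    rw [e1]
    calc _ = C⁻¹ * X⁻¹ * (C.transpose⁻¹ * C.transpose) * Y * C := by simp only [Matrix.mul_assoc]
      _ = _ := by rw [Matrix.nonsing_inv_mul _ hC']; simp only [Matrix.mul_assoc, Matrix.mul_one]
  have e3 : ∀ X : Matrix (Fin n) (Fin n) ℝ, (C⁻¹ * X * C).trace = X.trace := fun X => by
    rw [Matrix.trace_mul_comm, ← Matrix.mul_assoc, Matrix.mul_nonsing_inv _ hC, Matrix.one_mul]
  have e4 : ∀ X : Matrix (Fin n) (Fin n) ℝ, (C⁻¹ * X * C).det = X.det := fun X => by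
    rw [Matrix.det_mul_comm, ← Matrix.mul_assoc, Matrix.mul_nonsing_inv _ hC, Matrix.one_mul]
  rw [innerAt, innerAt, Matrix.mul_assoc (_ * _) _ (_ * _), e2, e2, e2, e4]
  congr 1
  calc _ = (C⁻¹ * (H⁻¹ * A) * (C * C⁻¹) * (H⁻¹ * B) * C).trace := by simp only [Matrix.mul_assoc]
    _ = (C⁻¹ * (H⁻¹ * A * H⁻¹ * B) * C).trace := by
      rw [Matrix.mul_nonsing_inv _ hC]; simp only [Matrix.mul_assoc, Matrix.one_mul]
    _ = _ := e3 _

lemma IsPath.congr (hC : IsUnit C.det) (h : IsPath H K γ) :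
    IsPath (C.transpose * H * C) (C.transpose * K * C) (fun t => C.transpose * γ t * C) := by
  refine ⟨fun i j => ?_, fun t ht => posDef_congr (h.posDef t ht) hC, by simp [h.source],
    by simp [h.target]⟩
  simp only [Matrix.mul_apply]
  refine ContDiff.sum fun k _ => ContDiff.mul (ContDiff.sum fun l _ => ?_) contDiff_const
  exact contDiff_const.mul (h.contDiff _ _)

lemma matrixDist_congr_le (hH : H.PosDef) (hK : K.PosDef) (hC : IsUnit C.det) :
    matrixDist (C.transpose * G * C) (C.transpose * H * C) (C.transpose * K * C)
      ≤ matrixDist G H K := by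
  refine le_of_forall_gt fun r hr => ?_
  obtain ⟨γ, hγ, hr⟩ := exists_isPath_lt hH hK hr
  refine (matrixDist_le (hγ.congr hC)).trans_lt (lt_of_eq_of_lt ?_ hr)
  simp only [pathLength, velocity_congr hγ.contDiff, innerAt_congr hC]

/-- The distance between scalar products does not depend on the basis. -/
lemma matrixDist_congr (hH : H.PosDef) (hK : K.PosDef) (hC : IsUnit C.det) :
    matrixDist (C.transpose * G * C) (C.transpose * H * C) (C.transpose * K * C)
      = matrixDist G H K := by
  refine le_antisymm (matrixDist_congr_le hH hK hC) ?_
  -- The reverse inequality is the same one for the congruence by `C⁻¹`, which undoes the first.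
  have hD : IsUnit (C⁻¹).det := Matrix.isUnit_nonsing_inv_det C hC
  have e : ∀ X : Matrix (Fin n) (Fin n) ℝ,
      (C⁻¹).transpose * (C.transpose * X * C) * C⁻¹ = X := fun X => by
    calc _ = (C * C⁻¹).transpose * X * (C * C⁻¹) := by
          simp only [Matrix.mul_assoc, Matrix.transpose_mul]
      _ = X := by rw [Matrix.mul_nonsing_inv _ hC]; simp
  have := matrixDist_congr_le (G := C.transpose * G * C) (posDef_congr hH hC)
    (posDef_congr hK hC) hD
  rwa [e, e, e] at this

-- With `H⁻¹ = Bᵀ B` and `S = B A Bᵀ`, which is symmetric, the trace equals `tr (Sᵀ S)`, the sum of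
-- the squares of the entries of `S`. It vanishes only if `S`, hence `A`, does.
open scoped MatrixOrder Matrix.Norms.L2Operator in
lemma trace_sq_pos (hH : H.PosDef) {A : Matrix (Fin n) (Fin n) ℝ} (hA : A.IsHermitian)
    (h0 : A ≠ 0) : 0 < (H⁻¹ * A * H⁻¹ * A).trace := by
  obtain ⟨B, hB, e⟩ : ∃ B : Matrix (Fin n) (Fin n) ℝ, IsUnit B.det ∧ H⁻¹ = B.conjTranspose * B := by
    have hi := hH.inv
    obtain ⟨B, hB⟩ := CStarAlgebra.nonneg_iff_eq_star_mul_self.1 hi.posSemidef.nonneg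
    rw [Matrix.star_eq_conjTranspose] at hB
    refine ⟨B, ?_, hB⟩
    have := hi.det_pos.ne'
    rw [hB, Matrix.det_mul] at this
    exact isUnit_iff_ne_zero.2 (right_ne_zero_of_mul this)
  set S := B * A * B.conjTranspose with hS
  have e1 : (H⁻¹ * A * H⁻¹ * A).trace = (S.conjTranspose * S).trace := by
    have : S.conjTranspose = S := by
      simp only [hS, Matrix.conjTranspose_mul, Matrix.conjTranspose_conjTranspose, hA.eq,
        Matrix.mul_assoc]
    rw [this, e]
    calc _ = (B.conjTranspose * (B * A * B.conjTranspose * B * A)).trace := by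
          simp only [Matrix.mul_assoc]
      _ = _ := by rw [Matrix.trace_mul_comm]; simp only [hS, Matrix.mul_assoc]
  rw [e1]
  refine lt_of_le_of_ne (Matrix.posSemidef_conjTranspose_mul_self S).trace_nonneg fun h => h0 ?_
  have h := Matrix.trace_conjTranspose_mul_self_eq_zero_iff.1 h.symm
  have hB' : IsUnit B.conjTranspose.det := by
    rwa [Matrix.conjTranspose_eq_transpose_of_trivial, Matrix.det_transpose]
  calc A = B⁻¹ * B * A * (B.conjTranspose * (B.conjTranspose)⁻¹) := by
        rw [Matrix.nonsing_inv_mul _ hB, Matrix.mul_nonsing_inv _ hB']; simp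
    _ = B⁻¹ * S * (B.conjTranspose)⁻¹ := by simp only [hS, Matrix.mul_assoc]
    _ = 0 := by rw [h]; simp

lemma continuousAt_inv_of_posDef (hH : H.PosDef) :
    ContinuousAt (fun A : Matrix (Fin n) (Fin n) ℝ => A⁻¹) H := by
  refine continuousAt_matrix_inv _ ?_
  rw [Ring.inverse_eq_inv']
  exact continuousAt_inv₀ hH.det_pos.ne'

lemma isClosed_setOf_isHermitian : IsClosed {A : Matrix (Fin n) (Fin n) ℝ | A.IsHermitian} :=
  isClosed_eq (continuous_id.matrix_conjTranspose) continuous_id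

lemma isClosed_setOf_posSemidef : IsClosed {A : Matrix (Fin n) (Fin n) ℝ | A.PosSemidef} := by
  have : {A : Matrix (Fin n) (Fin n) ℝ | A.PosSemidef} = {A | A.IsHermitian} ∩
      ⋂ x : Fin n → ℝ, {A | 0 ≤ star x ⬝ᵥ A.mulVec x} := by
    ext A
    simp [Matrix.posSemidef_iff_dotProduct_mulVec]
  rw [this]
  refine isClosed_setOf_isHermitian.inter (isClosed_iInter fun x => ?_)
  exact isClosed_le continuous_const
    (continuous_const.dotProduct (continuous_id.matrix_mulVec continuous_const))


lemma continuousAt_innerAt (hH : H.PosDef) (A : Matrix (Fin n) (Fin n) ℝ) :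
    ContinuousAt (fun q : Matrix (Fin n) (Fin n) ℝ × Matrix (Fin n) (Fin n) ℝ =>
      √(innerAt G q.1 q.2 q.2)) (H, A) := by
  have hi : ContinuousAt (fun q : Matrix (Fin n) (Fin n) ℝ × Matrix (Fin n) (Fin n) ℝ => q.1⁻¹)
      (H, A) :=
    ContinuousAt.comp (f := Prod.fst) (continuousAt_inv_of_posDef hH) continuousAt_fst
  have h1 : ContinuousAt (fun q : Matrix (Fin n) (Fin n) ℝ × Matrix (Fin n) (Fin n) ℝ =>
      (q.1⁻¹ * q.2 * q.1⁻¹ * q.2).trace) (H, A) :=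
    (Continuous.matrix_trace continuous_id).continuousAt.comp
      (((hi.mul continuousAt_snd).mul hi).mul continuousAt_snd)
  have h2 : Continuous (fun q : Matrix (Fin n) (Fin n) ℝ × Matrix (Fin n) (Fin n) ℝ =>
      √(G⁻¹ * q.1).det) :=
    ((continuous_const.matrix_mul continuous_fst).matrix_det).sqrt
  exact (h1.mul h2.continuousAt).sqrt

lemma innerAt_one_pos (hH : H.PosDef) {A : Matrix (Fin n) (Fin n) ℝ} (hA : A.IsHermitian)
    (h0 : A ≠ 0) : 0 < innerAt 1 H A A := by
  refine mul_pos (trace_sq_pos hH hA h0) (Real.sqrt_pos.2 ?_)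
  rw [inv_one, Matrix.one_mul]
  exact hH.det_pos

-- Local comparison with a norm, and definiteness of the distance

attribute [local instance] Matrix.normedAddCommGroup Matrix.normedSpace

/-- A semidefinite matrix is definite as soon as its determinant is nonzero. Since semidefiniteness
is a closed condition, this provides compact neighbourhoods inside the space of positive definite
matrices. -/
lemma exists_closedBall_posDef (hH : H.PosDef) : ∃ r > 0,
    ∀ X ∈ Metric.closedBall H r, X.PosSemidef → X.PosDef := by
  have hd : Continuous fun X : Matrix (Fin n) (Fin n) ℝ => X.det := continuous_id.matrix_det
  obtain ⟨r, hr, hb⟩ := Metric.nhds_basis_closedBall.mem_iff.1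
    (hd.continuousAt.preimage_mem_nhds (isOpen_Ioi.mem_nhds hH.det_pos))
  exact ⟨r, hr, fun X h1 h2 => h2.posDef_iff_det_ne_zero.2 (ne_of_gt (hb h1))⟩

/-- Near a positive definite matrix, the Riemannian metric is comparable with a norm. -/
lemma exists_innerAt_bounds (hH : H.PosDef) : ∃ r > 0, ∃ c > 0, ∃ C > 0,
    ∀ X : Matrix (Fin n) (Fin n) ℝ, X.PosDef → ‖X - H‖ ≤ r →
      ∀ A : Matrix (Fin n) (Fin n) ℝ, A.IsHermitian →
        c * ‖A‖ ≤ √(innerAt 1 X A A) ∧ √(innerAt 1 X A A) ≤ C * ‖A‖ := by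
  obtain ⟨r, hr, hpd⟩ := exists_closedBall_posDef hH
  -- The speed is continuous and positive on the compact set of base points near `H` and symmetric
  -- directions of norm one. Homogeneity in the direction extends its extremal bounds to all
  -- directions.
  have hSc : IsCompact (((Metric.closedBall H r) ∩ {X | X.PosSemidef}) ×ˢ
      (Metric.sphere 0 1 ∩ {A : Matrix (Fin n) (Fin n) ℝ | A.IsHermitian})) :=
    ((isCompact_closedBall H r).inter_right isClosed_setOf_posSemidef).prod
      ((isCompact_sphere 0 1).inter_right isClosed_setOf_isHermitian)
  have hcont : ContinuousOn (fun q : Matrix (Fin n) (Fin n) ℝ × Matrix (Fin n) (Fin n) ℝ =>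
      √(innerAt 1 q.1 q.2 q.2)) (((Metric.closedBall H r) ∩ {X | X.PosSemidef}) ×ˢ
      (Metric.sphere 0 1 ∩ {A : Matrix (Fin n) (Fin n) ℝ | A.IsHermitian})) := by
    rintro ⟨X, A⟩ ⟨⟨h1, h2⟩, -, -⟩
    exact (continuousAt_innerAt (hpd X h1 h2) A).continuousWithinAt
  obtain ⟨c, hc, hc'⟩ := hSc.exists_forall_le' hcont (a := 0) (by
    rintro ⟨X, A⟩ ⟨⟨h1, h2⟩, h3, h4⟩
    refine Real.sqrt_pos.2 (innerAt_one_pos (hpd X h1 h2) h4 ?_)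
    rintro rfl
    rw [mem_sphere_iff_norm, sub_zero, norm_zero] at h3
    exact zero_ne_one h3)
  obtain ⟨C, hC⟩ := hSc.bddAbove_image hcont
  -- For `n = 0` the unit sphere is empty and `C` is arbitrary; the maximum with 1 makes the
  -- constant positive in every case.
  refine ⟨r, hr, c, hc, max C 1, lt_max_of_lt_right one_pos, fun X hX hXr A hA => ?_⟩
  rcases eq_or_ne A 0 with rfl | h0
  · simp [innerAt]
  have hn : 0 < ‖A‖ := norm_pos_iff.2 h0
  have hmem : (X, ‖A‖⁻¹ • A) ∈ ((Metric.closedBall H r) ∩ {X | X.PosSemidef}) ×ˢ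
      (Metric.sphere 0 1 ∩ {A : Matrix (Fin n) (Fin n) ℝ | A.IsHermitian}) := by
    refine ⟨⟨by rwa [mem_closedBall_iff_norm], hX.posSemidef⟩, ?_, ?_⟩
    · rw [mem_sphere_iff_norm, sub_zero, norm_smul, norm_inv, norm_norm, inv_mul_cancel₀ hn.ne']
    · exact hA.smul (k := ‖A‖⁻¹) (by simp [IsSelfAdjoint])
  have e : √(innerAt 1 X A A) = √(innerAt 1 X (‖A‖⁻¹ • A) (‖A‖⁻¹ • A)) * ‖A‖ := by
    rw [innerAt_smul, abs_of_pos (inv_pos.2 hn), mul_assoc, inv_mul_cancel₀ hn.ne', mul_one]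
  have e1 := hc' _ hmem
  have e2 := hC (mem_image_of_mem _ hmem)
  dsimp only at e1 e2
  rw [e]
  clear hmem hC hc' hcont hSc e
  generalize √(innerAt 1 X (‖A‖⁻¹ • A) (‖A‖⁻¹ • A)) = s at *
  exact ⟨mul_le_mul_of_nonneg_right e1 hn.le,
    mul_le_mul_of_nonneg_right (e2.trans (le_max_left _ _)) hn.le⟩

/-- The path is known to be symmetric only for times in `[0, 1]`. To include the endpoints, the
derivatives of the entries are compared as derivatives within this interval, where they are unique.
-/
lemma IsPath.isHermitian_velocity (h : IsPath H K γ) {t : ℝ} (ht : t ∈ Icc (0 : ℝ) 1) :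
    (velocity γ t).IsHermitian := by
  ext i j
  have hd : ∀ i j, HasDerivAt (fun s => γ s i j) (velocity γ t i j) t := fun i j =>
    ((h.contDiff i j).differentiable one_ne_zero _).hasDerivAt
  have hu := (uniqueDiffOn_Icc (zero_lt_one' ℝ)) t ht
  refine hu.eq_deriv _ ((hd j i).hasDerivWithinAt) ((hd i j).hasDerivWithinAt.congr ?_ ?_)
  · intro s hs
    exact (h.posDef s hs).1.apply i j
  · exact (h.posDef t ht).1.apply i j

/-- The straight segment stays in the ball and has constant velocity `K - H`, so the upper
comparison with the norm bounds its length. -/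
lemma matrixDist_le_of_near (hH : H.PosDef) : ∃ r > 0, ∃ C > 0,
    ∀ K : Matrix (Fin n) (Fin n) ℝ, K.PosDef → ‖K - H‖ ≤ r → matrixDist 1 H K ≤ C * ‖K - H‖ := by
  obtain ⟨r, hr, _, _, C, hC, hb⟩ := exists_innerAt_bounds hH
  refine ⟨r, hr, C, hC, fun K hK hKr => ?_⟩
  have hp : IsPath H K (fun t => (1 - t) • H + t • K) := by
    refine ⟨?_, ?_, by simp, by simp⟩
    · intro i j
      simp only [Matrix.add_apply, Matrix.smul_apply, smul_eq_mul]
      fun_prop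
    · rintro t ⟨h0, h1⟩
      rcases h0.eq_or_lt with rfl | h0
      · simpa using hH
      · exact Matrix.PosDef.posSemidef_add (hH.posSemidef.smul (by linarith)) (hK.smul h0)
  have hv : ∀ t, velocity (fun t : ℝ => (1 - t) • H + t • K) t = K - H := by
    intro t
    ext i j
    simp only [velocity, Matrix.of_apply, Matrix.add_apply, Matrix.smul_apply, smul_eq_mul,
      Matrix.sub_apply]
    refine HasDerivAt.deriv ?_
    have := (((hasDerivAt_id' t).const_sub 1).mul_const (H i j)).add
      ((hasDerivAt_id' t).mul_const (K i j))
    exact this.congr_deriv (by ring)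
  refine (matrixDist_le hp).trans ?_
  have := intervalIntegral.norm_integral_le_of_norm_le_const (a := 0) (b := 1) (C := C * ‖K - H‖)
    (f := fun t => √(innerAt 1 ((1 - t) • H + t • K)
      (velocity (fun t : ℝ => (1 - t) • H + t • K) t)
      (velocity (fun t : ℝ => (1 - t) • H + t • K) t))) (fun t ht => ?_)
  · refine (le_abs_self _).trans (this.trans_eq ?_)
    simp
  · rw [uIoc_of_le zero_le_one] at ht
    have ht' : t ∈ Icc (0 : ℝ) 1 := ⟨ht.1.le, ht.2⟩
    rw [Real.norm_of_nonneg (Real.sqrt_nonneg _), hv]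
    refine (hb _ (hp.posDef t ht') ?_ _ (hK.1.sub hH.1)).2
    have : (1 - t) • H + t • K - H = t • (K - H) := by
      rw [sub_smul, one_smul, smul_sub]; abel
    rw [this, norm_smul, Real.norm_of_nonneg ht'.1]
    exact (mul_le_of_le_one_left (norm_nonneg _) ht'.2).trans hKr

/-- Inside the ball where the Riemannian metric dominates `c` times the norm, the displacement is at
most `c⁻¹` times the length. A path that is too short therefore never leaves this ball, and cannot
reach `K`. -/
lemma eq_of_matrixDist_one_eq_zero (hH : H.PosDef) (hK : K.PosDef) (h0 : matrixDist 1 H K = 0) :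
    H = K := by
  obtain ⟨r, hr, c, hc, _, _, hb⟩ := exists_innerAt_bounds hH
  by_contra hne
  have hn : 0 < ‖K - H‖ := norm_pos_iff.2 (sub_ne_zero.2 (Ne.symm hne))
  set ρ := min r ‖K - H‖ with hρ
  have hρ0 : 0 < ρ := lt_min hr hn
  obtain ⟨γ, hγ, hL⟩ := exists_isPath_lt (G := 1) (r := c * ρ / 4) hH hK
    (by rw [h0]; positivity)
  set s : ℝ → ℝ := fun t => √(innerAt 1 (γ t) (velocity γ t) (velocity γ t)) with hs
  have hsc : ContinuousOn s (Icc 0 1) := continuousOn_speed hγ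
  have hsi : ∀ t ∈ Icc (0 : ℝ) 1, IntervalIntegrable s volume 0 t := fun t ht => by
    apply ContinuousOn.intervalIntegrable
    rw [uIcc_of_le ht.1]
    exact hsc.mono (Icc_subset_Icc le_rfl ht.2)
  have hIle : ∀ t ∈ Icc (0 : ℝ) 1, ∫ u in (0 : ℝ)..t, s u ≤ c * ρ / 4 := fun t ht => by
    refine le_trans ?_ hL.le
    refine intervalIntegral.integral_mono_interval le_rfl ht.1 ht.2
      (Filter.Eventually.of_forall fun _ => Real.sqrt_nonneg _) (hsi 1 ⟨zero_le_one, le_rfl⟩)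
  -- Barrier for `‖γ t - H‖`. The linear term makes the comparison of derivatives strict; each of
  -- the two terms stays below `ρ / 4`, so the barrier ends below `‖K - H‖`.
  set B : ℝ → ℝ := fun t => c⁻¹ * (∫ u in (0 : ℝ)..t, s u) + ρ / 4 * t with hB
  have hBle : ∀ t ∈ Icc (0 : ℝ) 1, B t ≤ ρ / 2 := fun t ht => by
    have h1 := mul_le_mul_of_nonneg_left (hIle t ht) (inv_pos.2 hc).le
    have h2 : c⁻¹ * (c * ρ / 4) = ρ / 4 := by field_simp
    have h3 : ρ / 4 * t ≤ ρ / 4 := mul_le_of_le_one_right (by positivity) ht.2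
    simp only [hB]
    linarith
  have hder : ∀ t ∈ Ico (0 : ℝ) 1, HasDerivWithinAt (fun t => γ t - H) (velocity γ t) (Ici t) t := by
    intro t _
    refine HasDerivWithinAt.sub_const _ ?_
    refine HasDerivAt.hasDerivWithinAt ?_
    refine hasDerivAt_pi.2 fun i => hasDerivAt_pi.2 fun j => ?_
    exact ((hγ.contDiff i j).differentiable one_ne_zero _).hasDerivAt
  have hγc : Continuous γ := continuous_matrix fun i j => (hγ.contDiff i j).continuous
  have key := image_norm_le_of_norm_deriv_right_lt_deriv_boundary' (a := 0) (b := 1)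
    (f := fun t => γ t - H) (f' := velocity γ) (B := B) (B' := fun t => c⁻¹ * s t + ρ / 4)
    (hγc.sub continuous_const).continuousOn hder (by simp [hγ.source, hB])
    (ContinuousOn.add (continuousOn_const.mul
      (intervalIntegral.continuousOn_primitive_interval' (by
        exact hsi 1 ⟨zero_le_one, le_rfl⟩) (by simp) |>.mono (by simp)))
      (by fun_prop)) (fun t ht => ?_) (fun t ht he => ?_) (right_mem_Icc.2 zero_le_one)
  · have := key.trans (hBle 1 ⟨zero_le_one, le_rfl⟩)
    rw [hγ.target] at this
    have h2 : ρ ≤ ‖K - H‖ := min_le_right _ _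
    linarith
  · refine HasDerivWithinAt.add (HasDerivWithinAt.const_mul _ ?_) ?_
    · have hcw : ContinuousWithinAt s (Ioi t) t :=
        (hsc t ⟨ht.1, ht.2.le⟩).mono_of_mem_nhdsWithin
          (mem_nhdsWithin.2 ⟨Iio 1, isOpen_Iio, ht.2, fun u hu => ⟨ht.1.trans hu.2.le, hu.1.le⟩⟩)
      refine intervalIntegral.integral_hasDerivWithinAt_right (hsi t ⟨ht.1, ht.2.le⟩)
        (t := Ioi t) ?_ hcw
      refine ⟨Ioo t 1, Ioo_mem_nhdsGT ht.2, ?_⟩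
      refine ContinuousOn.aestronglyMeasurable (hsc.mono ?_) measurableSet_Ioo
      exact fun u hu => ⟨ht.1.trans hu.1.le, hu.2.le⟩
    · simpa using ((hasDerivAt_id t).const_mul (ρ / 4)).hasDerivWithinAt
  -- The derivatives need comparing only at times when the path touches the barrier. It is then
  -- within `ρ / 2 ≤ r` of `H`, so the lower bound on the speed is available.
  · have ht' : t ∈ Icc (0 : ℝ) 1 := ⟨ht.1, ht.2.le⟩
    have h1 : ‖γ t - H‖ ≤ r := by
      rw [he]
      exact (hBle t ht').trans ((half_le_self hρ0.le).trans (min_le_left _ _))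
    have h2 := (hb _ (hγ.posDef t ht') h1 _ (hγ.isHermitian_velocity ht')).1
    have h3 : ‖velocity γ t‖ ≤ c⁻¹ * s t := by
      rw [inv_mul_eq_div, le_div_iff₀ hc, mul_comm]
      exact h2
    exact h3.trans_lt (lt_add_of_pos_right _ (by positivity))

end Matrices

/-! ### The completion of the space of positive definite matrices -/

section Completion

variable {n : ℕ} {G H K : Matrix (Fin n) (Fin n) ℝ}

open Classical in
/-- A positive definite matrix as a point of the completion `PBar n`. -/
def toPBar (X : Matrix (Fin n) (Fin n) ℝ) : PBar n :=
  if h : X.PosDef then ((⟨X, h⟩ : PosDefMatrix n) : PBar n)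
  else ((⟨1, Matrix.PosDef.one⟩ : PosDefMatrix n) : PBar n)

lemma toPBar_of_posDef (hH : H.PosDef) : toPBar H = ((⟨H, hH⟩ : PosDefMatrix n) : PBar n) :=
  dif_pos hH

lemma dist_toPBar (hH : H.PosDef) (hK : K.PosDef) :
    dist (toPBar H) (toPBar K) = matrixDist 1 H K := by
  rw [toPBar_of_posDef hH, toPBar_of_posDef hK, UniformSpace.Completion.dist_eq]
  rfl

lemma continuousOn_toPBar : ContinuousOn (toPBar (n := n)) {X | X.PosDef} := by
  let : NormedAddCommGroup (Matrix (Fin n) (Fin n) ℝ) := Matrix.normedAddCommGroup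
  intro H hH
  obtain ⟨r, hr, C, -, hb⟩ := matrixDist_le_of_near hH
  refine tendsto_iff_dist_tendsto_zero.2 ?_
  refine squeeze_zero' (g := fun K => C * ‖K - H‖)
    (Filter.Eventually.of_forall fun _ => dist_nonneg) ?_ ?_
  · filter_upwards [self_mem_nhdsWithin,
      mem_nhdsWithin_of_mem_nhds (Metric.closedBall_mem_nhds H hr)] with K hK hKr
    rw [dist_comm, dist_toPBar hH hK]
    exact hb K hK (by rwa [mem_closedBall_iff_norm] at hKr)
  · have : Continuous fun K : Matrix (Fin n) (Fin n) ℝ => C * ‖K - H‖ :=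
      continuous_const.mul (continuous_id.sub continuous_const).norm
    have h2 := (this.tendsto H).mono_left (nhdsWithin_le_nhds (s := {X | X.PosDef}))
    simpa using h2

lemma dense_image_toPBar {D : Set {X : Matrix (Fin n) (Fin n) ℝ // X.PosDef}} (hD : Dense D) :
    Dense ((fun X => toPBar X.1) '' D) := by
  have hc : Continuous fun X : {X : Matrix (Fin n) (Fin n) ℝ // X.PosDef} => toPBar X.1 :=
    continuousOn_iff_continuous_domRestrict.1 continuousOn_toPBar
  refine DenseRange.dense_image ?_ hc hD
  refine (UniformSpace.Completion.denseRange_coe (α := PosDefMatrix n)).mono ?_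
  rintro _ ⟨X, rfl⟩
  exact ⟨⟨X.1, X.2⟩, toPBar_of_posDef X.2⟩

instance : SecondCountableTopology (Matrix (Fin n) (Fin n) ℝ) :=
  inferInstanceAs (SecondCountableTopology (Fin n → Fin n → ℝ))

instance : TopologicalSpace.SeparableSpace (PBar n) := by
  have : SecondCountableTopology {X : Matrix (Fin n) (Fin n) ℝ // X.PosDef} :=
    TopologicalSpace.Subtype.secondCountableTopology _
  obtain ⟨D, hD, hd⟩ := TopologicalSpace.exists_countable_dense
    {X : Matrix (Fin n) (Fin n) ℝ // X.PosDef}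
  exact ⟨_, hD.image _, dense_image_toPBar hd⟩

/-- Needed in dimension zero, where the volume measure has atoms and `M` is not isomorphic to the
interval. -/
instance : Subsingleton (PosDefMatrix 0) :=
  ⟨fun ⟨A, _⟩ ⟨B, _⟩ => by congr; exact Subsingleton.elim A B⟩

instance : Subsingleton (PBar 0) := by
  refine ⟨fun a b => ?_⟩
  induction a, b using UniformSpace.Completion.induction_on₂ with
  | hp => exact isClosed_eq continuous_fst continuous_snd
  | ih a b => rw [Subsingleton.elim a b]

/-- The positive definite matrix `G^{-1/2}`. -/
def invSqrt (G : Matrix (Fin n) (Fin n) ℝ) : Matrix (Fin n) (Fin n) ℝ :=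
  cfc (fun x : ℝ => (√x)⁻¹) G

open scoped MatrixOrder Matrix.Norms.L2Operator in
lemma spectrum_subset_Ioi (hG : G.PosDef) : spectrum ℝ G ⊆ Ioi 0 := by
  intro x hx
  have := hG.isStrictlyPositive
  exact this.spectrum_pos hx

/-- The columns of `invSqrt G` form an orthonormal basis for `G`. Congruence by it thus replaces the
reference matrix `G` by 1. -/
lemma invSqrt_transpose_mul_mul (hG : G.PosDef) :
    (invSqrt G).transpose * G * invSqrt G = 1 := by
  have hc : ContinuousOn (fun x : ℝ => (√x)⁻¹) (spectrum ℝ G) := fun x hx =>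
    (Real.continuous_sqrt.continuousAt.inv₀
      (Real.sqrt_pos.2 (spectrum_subset_Ioi hG hx)).ne').continuousWithinAt
  have ht : (invSqrt G).transpose = invSqrt G := by
    rw [← Matrix.conjTranspose_eq_transpose_of_trivial]
    exact IsSelfAdjoint.cfc
  have hs : IsSelfAdjoint G := hG.1
  rw [ht]
  nth_rw 2 [← cfc_id' ℝ G]
  rw [invSqrt, ← cfc_mul _ _ G, ← cfc_mul _ _ G, ← cfc_one ℝ G]
  refine cfc_congr fun x hx => ?_
  have := Real.sqrt_pos.2 (spectrum_subset_Ioi hG hx)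
  have h2 := Real.mul_self_sqrt (le_of_lt (spectrum_subset_Ioi hG hx))
  simp only [Pi.one_apply]
  field_simp
  linarith

lemma isUnit_det_invSqrt (hG : G.PosDef) : IsUnit (invSqrt G).det := by
  have := congrArg Matrix.det (invSqrt_transpose_mul_mul hG)
  rw [Matrix.det_mul, Matrix.det_one] at this
  exact IsUnit.of_mul_eq_one_right _ this

-- The functional calculus depends continuously on the matrix as long as the spectra stay where `x ↦
-- (√x)⁻¹` is continuous, here in the open half-line.
open scoped Matrix.Norms.L2Operator in
lemma continuousOn_invSqrt : ContinuousOn (invSqrt (n := n)) {X | X.PosDef} := by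
  refine ContinuousOn.cfc_of_mem_nhdsSet (s := Ioi 0) _ ?_ continuousOn_id ?_ ?_
  · exact isOpen_Ioi.mem_nhdsSet.2 (iUnion₂_subset fun G hG => spectrum_subset_Ioi hG)
  · intro G hG
    exact hG.1
  · intro x hx
    exact (Real.continuous_sqrt.continuousAt.inv₀ (Real.sqrt_pos.2 hx).ne').continuousWithinAt

end Completion

/-! ### Completeness of spaces of square integrable maps -/

section L2Complete

variable {Ω : Type*} [MeasurableSpace Ω] {μ : Measure Ω} {X : Type*} [MetricSpace X]

lemma L2Map.dist_eq [IsFiniteMeasure μ] (f g : L2Map μ X) :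
    dist f g = (eLpNorm (fun p => dist (f.1 p) (g.1 p)) 2 μ).toReal :=
  sqrt_integral_sq (memLp_dist f g)

/-- The class of a measurable map at square integrable distance from a constant map. -/
def L2Map.mk (f : Ω → X) (hf : AEStronglyMeasurable f μ) (A : X)
    (hA : MemLp (fun p => dist (f p) A) 2 μ) : L2Map μ X := by
  refine ⟨AEEqFun.mk f hf, A, (memLp_two_iff_integrable_sq
    ((AEEqFun.aestronglyMeasurable _).dist aestronglyMeasurable_const)).1 (hA.ae_eq ?_)⟩
  filter_upwards [AEEqFun.coeFn_mk f hf] with p hp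
  rw [hp]

lemma L2Map.coeFn_mk (f : Ω → X) (hf : AEStronglyMeasurable f μ) (A : X)
    (hA : MemLp (fun p => dist (f p) A) 2 μ) : (L2Map.mk f hf A hA).1 =ᵐ[μ] f :=
  AEEqFun.coeFn_mk f hf

lemma memLp_kuratowski [IsFiniteMeasure μ] [TopologicalSpace.SeparableSpace X] (f : L2Map μ X) :
    MemLp (fun p => kuratowskiEmbedding X (f.1 p)) 2 μ := by
  obtain ⟨A, hA⟩ := f.2
  have hk := kuratowskiEmbedding.isometry X
  have h1 : MemLp (fun p => dist (f.1 p) A) 2 μ :=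
    (memLp_two_iff_integrable_sq (f.1.aestronglyMeasurable.dist aestronglyMeasurable_const)).2 hA
  refine (h1.add (memLp_const ‖kuratowskiEmbedding X A‖)).mono
    (hk.continuous.comp_aestronglyMeasurable f.1.aestronglyMeasurable)
    (Filter.Eventually.of_forall fun p => ?_)
  simp only [Pi.add_apply, Real.norm_eq_abs]
  rw [abs_of_nonneg (by positivity), ← hk.dist_eq, dist_eq_norm]
  exact norm_le_norm_sub_add _ _

/-- The isometric embedding of `L²(Ω, X)` into a Lebesgue space given by the Kuratowski
embedding of `X`. -/
def L2Map.toLp [IsFiniteMeasure μ] [TopologicalSpace.SeparableSpace X] (f : L2Map μ X) :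
    Lp (lp (fun _ : ℕ => ℝ) ⊤) 2 μ :=
  (memLp_kuratowski f).toLp

lemma L2Map.isometry_toLp [IsFiniteMeasure μ] [TopologicalSpace.SeparableSpace X] :
    Isometry (L2Map.toLp (μ := μ) (X := X)) := by
  refine Isometry.of_dist_eq fun f g => ?_
  rw [Lp.dist_def, L2Map.dist_eq]
  congr 1
  refine eLpNorm_congr_norm_ae ?_
  filter_upwards [(memLp_kuratowski f).coeFn_toLp, (memLp_kuratowski g).coeFn_toLp] with p hf hg
  rw [Pi.sub_apply, L2Map.toLp, L2Map.toLp, hf, hg, ← dist_eq_norm,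
    (kuratowskiEmbedding.isometry X).dist_eq, Real.norm_of_nonneg dist_nonneg]

/-- A Cauchy sequence has a limit `F` in the ambient Lebesgue space, and a subsequence converges
almost everywhere. As `X` is complete, its Kuratowski image is closed, so `F` takes values in it
almost everywhere and descends to a map into `X`. -/
instance [IsFiniteMeasure μ] [TopologicalSpace.SeparableSpace X] [CompleteSpace X] :
    CompleteSpace (L2Map μ X) := by
  refine Metric.complete_of_cauchySeq_tendsto fun u hu => ?_
  have hJ := L2Map.isometry_toLp (μ := μ) (X := X)
  have hk := kuratowskiEmbedding.isometry X
  obtain ⟨F, hF⟩ := cauchySeq_tendsto_of_complete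
    (hJ.uniformContinuous.comp_cauchySeq hu)
  obtain ⟨A, -⟩ := (u 0).2
  obtain ⟨φ, -, hφ⟩ := (tendstoInMeasure_of_tendsto_Lp hF).exists_seq_tendsto_ae
  have hmem : ∀ᵐ p ∂μ, F p ∈ range (kuratowskiEmbedding X) := by
    have h1 : ∀ᵐ p ∂μ, ∀ m, (L2Map.toLp (u m)) p = kuratowskiEmbedding X ((u m).1 p) :=
      ae_all_iff.2 fun m => (memLp_kuratowski (u m)).coeFn_toLp
    filter_upwards [hφ, h1] with p hp h1
    refine hk.isClosedEmbedding.isClosed_range.mem_of_tendsto hp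
      (Filter.Eventually.of_forall fun m => ?_)
    exact ⟨_, (h1 _).symm⟩
  have : Nonempty X := ⟨A⟩
  set f : Ω → X := fun p => Function.invFun (kuratowskiEmbedding X) (F p) with hf
  have hkf : (fun p => kuratowskiEmbedding X (f p)) =ᵐ[μ] F := by
    filter_upwards [hmem] with p hp
    exact Function.invFun_eq hp
  have hfm : AEStronglyMeasurable f μ :=
    hk.isEmbedding.aestronglyMeasurable_comp_iff.1
      ((Lp.aestronglyMeasurable F).congr hkf.symm)
  have hfi : MemLp (fun p => dist (f p) A) 2 μ := by
    refine ((Lp.memLp F).sub (memLp_const (kuratowskiEmbedding X A))).norm.ae_eq ?_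
    filter_upwards [hkf] with p h1
    rw [← hk.dist_eq, dist_eq_norm, Pi.sub_apply, ← h1]
  refine ⟨L2Map.mk f hfm A hfi, ?_⟩
  rw [hJ.isEmbedding.tendsto_nhds_iff]
  convert hF using 2
  refine Lp.ext ?_
  refine (memLp_kuratowski _).coeFn_toLp.trans (Filter.EventuallyEq.trans ?_ hkf)
  filter_upwards [L2Map.coeFn_mk f hfm A hfi] with p h2
  rw [h2]

end L2Complete

/-! ### Atomless probability spaces -/

section MeasureIso

open ProbabilityTheory Filter

/-- The quantile function of a probability measure on the line. -/
def quantile (μ : Measure ℝ) (u : unitInterval) : ℝ :=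
  if u ∈ Ioo (0 : unitInterval) 1 then sInf {x | (u : ℝ) ≤ cdf μ x} else 0

variable {μ : Measure ℝ}

/-- Right continuity of the distribution function means that the infimum is attained. The endpoints
are excluded because the set is unbounded below for `u = 0` and may be empty for `u = 1`. -/
lemma quantile_le_iff {u : unitInterval} (hu : u ∈ Ioo (0 : unitInterval) 1) {x : ℝ} :
    quantile μ u ≤ x ↔ (u : ℝ) ≤ cdf μ x := by
  rw [quantile, if_pos hu]
  have hu0 : (0 : ℝ) < u := hu.1
  have hu1 : (u : ℝ) < 1 := hu.2
  have hne : {x | (u : ℝ) ≤ cdf μ x}.Nonempty := by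
    obtain ⟨x, hx⟩ := ((tendsto_cdf_atTop μ).eventually (lt_mem_nhds hu1)).exists
    exact ⟨x, hx.le⟩
  have hbdd : BddBelow {x | (u : ℝ) ≤ cdf μ x} := by
    obtain ⟨x, hx⟩ := ((tendsto_cdf_atBot μ).eventually (gt_mem_nhds hu0)).exists
    refine ⟨x, fun y hy => le_of_not_ge fun h => ?_⟩
    exact (hx.trans_le hy).not_ge (monotone_cdf μ h)
  refine ⟨fun h => ?_, fun h => csInf_le hbdd h⟩
  refine le_trans ?_ (monotone_cdf μ h)
  have hr := ((cdf μ).right_continuous (sInf {x | (u : ℝ) ≤ cdf μ x})).mono_left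
    (nhdsWithin_mono _ Ioi_subset_Ici_self)
  refine ge_of_tendsto hr ?_
  filter_upwards [self_mem_nhdsWithin] with y hy
  obtain ⟨z, hz, hzy⟩ := exists_lt_of_csInf_lt hne hy
  exact hz.trans (monotone_cdf μ hzy.le)

lemma ae_mem_Ioo_unitInterval : ∀ᵐ u : unitInterval, u ∈ Ioo (0 : unitInterval) 1 := by
  have h0 : ∀ᵐ u : unitInterval, u ≠ 0 := by simp [ae_iff]
  have h1 : ∀ᵐ u : unitInterval, u ≠ 1 := by simp [ae_iff]
  filter_upwards [h0, h1] with u h0 h1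
  exact ⟨unitInterval.pos_iff_ne_zero.2 h0, unitInterval.lt_one_iff_ne_one.2 h1⟩

lemma measurable_quantile : Measurable (quantile μ) := by
  refine measurable_of_Iic fun x => ?_
  have : quantile μ ⁻¹' Iic x = (Ioo 0 1 ∩ {u : unitInterval | (u : ℝ) ≤ cdf μ x})
      ∪ ((Ioo 0 1)ᶜ ∩ {_u : unitInterval | (0 : ℝ) ≤ x}) := by
    ext u
    by_cases hu : u ∈ Ioo (0 : unitInterval) 1
    · simp only [mem_preimage, mem_Iic, quantile_le_iff hu]
      simp [hu.1, hu.2]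
    · have hq : quantile μ u = 0 := if_neg hu
      simp only [mem_preimage, mem_Iic, hq, mem_union, mem_inter_iff, hu,
        mem_compl_iff, mem_ofPred_eq, false_and, not_false_eq_true, true_and, false_or]
  rw [this]
  exact (measurableSet_Ioo.inter (measurableSet_le measurable_subtype_coe measurable_const)).union
    (measurableSet_Ioo.compl.inter (MeasurableSet.const _))

lemma measurePreserving_quantile [IsProbabilityMeasure μ] :
    MeasurePreserving (quantile μ) volume μ := by
  refine ⟨measurable_quantile, ?_⟩
  have := Measure.isProbabilityMeasure_map (μ := (volume : Measure unitInterval))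
    (measurable_quantile (μ := μ)).aemeasurable
  refine Measure.ext_of_Iic _ _ fun x => ?_
  rw [Measure.map_apply measurable_quantile measurableSet_Iic, ← ofReal_cdf]
  set y : unitInterval := ⟨cdf μ x, cdf_nonneg μ x, cdf_le_one μ x⟩
  have : ENNReal.ofReal (cdf μ x) = volume (Iic y) := (unitInterval.volume_Iic y).symm
  rw [this]
  refine measure_congr ?_
  filter_upwards [ae_mem_Ioo_unitInterval] with u hu
  exact propext (quantile_le_iff hu)

/-- Without atoms the distribution function has no jumps. To the left of the quantile its values lie
below `u`, and so does their limit, which is the value at the quantile. -/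
lemma cdf_quantile [IsProbabilityMeasure μ] (h0 : ∀ x, μ {x} = 0) {u : unitInterval}
    (hu : u ∈ Ioo (0 : unitInterval) 1) : cdf μ (quantile μ u) = u := by
  refine le_antisymm ?_ ((quantile_le_iff hu).1 le_rfl)
  have h1 := (cdf μ).measure_singleton (quantile μ u)
  rw [measure_cdf, h0, eq_comm, ENNReal.ofReal_eq_zero, sub_nonpos] at h1
  refine h1.trans (le_of_tendsto ((monotone_cdf μ).tendsto_leftLim _) ?_)
  filter_upwards [self_mem_nhdsWithin] with y hy
  exact le_of_not_ge fun h => hy.not_ge ((quantile_le_iff hu).2 h)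

/-- A standard Borel probability space without atoms is isomorphic modulo null sets to the unit
interval. -/
theorem exists_measurePreserving_unitInterval {Ω : Type*} [MeasurableSpace Ω]
    [StandardBorelSpace Ω] (ν : Measure Ω) [IsProbabilityMeasure ν] (h0 : ∀ x, ν {x} = 0) :
    ∃ (T : Ω → unitInterval) (S : unitInterval → Ω), MeasurePreserving T ν volume ∧
      MeasurePreserving S volume ν ∧ (∀ᵐ u, T (S u) = u) ∧ ∀ᵐ p ∂ν, S (T p) = p := by
  have hc : ¬ Countable Ω := fun h => by
    have : NullSingletonClass ν := ⟨h0⟩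
    have : ν univ = 0 := countable_univ.measure_zero ν
    simp at this
  have hcR : ¬ Countable ℝ := fun h => Cardinal.not_countable_real (countable_univ (α := ℝ))
  set e : Ω ≃ᵐ ℝ := PolishSpace.measurableEquivOfNotCountable hc hcR
  set μ := ν.map e with hμ
  have := Measure.isProbabilityMeasure_map (μ := ν) e.measurable.aemeasurable
  have hμ0 : ∀ x, μ {x} = 0 := fun x => by
    rw [hμ, e.map_apply]
    have : e ⁻¹' {x} = {e.symm x} := by
      ext p
      simp [e.eq_symm_apply]
    rw [this, h0]
  have he : MeasurePreserving e.symm μ ν :=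
    (MeasurePreserving.mk e.measurable hμ.symm).symm e
  set F : ℝ → unitInterval := fun x => ⟨cdf μ x, cdf_nonneg μ x, cdf_le_one μ x⟩
  have hF : Measurable F := (monotone_cdf μ).measurable.subtype_mk
  have hS : MeasurePreserving (fun u => e.symm (quantile μ u)) volume ν :=
    he.comp measurePreserving_quantile
  have hTS : ∀ᵐ u : unitInterval, F (e (e.symm (quantile μ u))) = u := by
    filter_upwards [ae_mem_Ioo_unitInterval] with u hu
    rw [e.apply_symm_apply]
    exact Subtype.ext (cdf_quantile hμ0 hu)
  have hTm : Measurable fun p => F (e p) := hF.comp e.measurable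
  refine ⟨fun p => F (e p), fun u => e.symm (quantile μ u), ⟨hTm, ?_⟩, hS, hTS, ?_⟩
  · rw [← hS.map_eq, Measure.map_map hTm hS.measurable]
    refine (Measure.map_congr hTS).trans Measure.map_id
  -- As `ν` is the image of Lebesgue measure under `S`, it suffices to test the identity at points
  -- `S u`, where it follows from `T (S u) = u`.
  · rw [← hS.map_eq, ae_map_iff hS.measurable.aemeasurable]
    · filter_upwards [hTS] with u hu
      rw [hu]
    · have : MeasurableSet {p | quantile μ (F (e p)) = e p} :=
        measurableSet_eq_fun (measurable_quantile.comp hTm) e.measurable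
      convert this using 3
      exact e.symm_apply_eq

end MeasureIso

/-! ### Change of the parameter space -/

section Transport

variable {Ω Ω' : Type*} [MeasurableSpace Ω] [MeasurableSpace Ω'] {μ : Measure Ω} {ν : Measure Ω'}
  {X : Type*} [MetricSpace X]

/-- Composition of a square integrable map with a measure preserving map. -/
def L2Map.comp (f : L2Map ν X) (T : Ω → Ω') (hT : MeasurePreserving T μ ν) : L2Map μ X := by
  refine ⟨f.1.compMeasurePreserving T hT, ?_⟩
  obtain ⟨A, hA⟩ := f.2
  refine ⟨A, (hT.integrable_comp_of_integrable hA).congr ?_⟩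
  filter_upwards [f.1.coeFn_compMeasurePreserving hT] with p hp
  rw [hp]
  rfl

lemma L2Map.isometry_comp [IsFiniteMeasure μ] [IsFiniteMeasure ν] (T : Ω → Ω')
    (hT : MeasurePreserving T μ ν) : Isometry fun f : L2Map ν X => f.comp T hT := by
  refine Isometry.of_dist_eq fun f g => ?_
  rw [L2Map.dist_eq, L2Map.dist_eq, ← eLpNorm_comp_measurePreserving (memLp_dist f g).1 hT]
  congr 1
  refine eLpNorm_congr_ae ?_
  filter_upwards [f.1.coeFn_compMeasurePreserving hT, g.1.coeFn_compMeasurePreserving hT]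
    with p h1 h2
  simp only [L2Map.comp, h1, h2, Function.comp_apply]

/-- An isomorphism modulo null sets of the parameter spaces induces an isometry. -/
def L2Map.isometryEquiv [IsFiniteMeasure μ] [IsFiniteMeasure ν] {T : Ω → Ω'} {S : Ω' → Ω}
    (hT : MeasurePreserving T μ ν) (hS : MeasurePreserving S ν μ) (hTS : ∀ᵐ u ∂ν, T (S u) = u)
    (hST : ∀ᵐ p ∂μ, S (T p) = p) : L2Map μ X ≃ᵢ L2Map ν X where
  toFun f := f.comp S hS
  invFun f := f.comp T hT
  left_inv f := by
    refine Subtype.ext (AEEqFun.ext ?_)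
    refine (AEEqFun.coeFn_compMeasurePreserving _ hT).trans ?_
    filter_upwards [hT.quasiMeasurePreserving.ae (f.1.coeFn_compMeasurePreserving hS), hST]
      with p h1 h2
    simp only [L2Map.comp, Function.comp_apply] at h1 ⊢
    rw [h1, h2]
  right_inv f := by
    refine Subtype.ext (AEEqFun.ext ?_)
    refine (AEEqFun.coeFn_compMeasurePreserving _ hS).trans ?_
    filter_upwards [hS.quasiMeasurePreserving.ae (f.1.coeFn_compMeasurePreserving hT), hTS]
      with p h1 h2
    simp only [L2Map.comp, Function.comp_apply] at h1 ⊢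
    rw [h1, h2]
  isometry_toFun := L2Map.isometry_comp S hS

end Transport

/-! ### Gram matrices in local frames -/

section Bilinear

variable {n : ℕ}

lemma bilin_apply_eq_sum (b : EuclideanSpace ℝ (Fin n) →L[ℝ] EuclideanSpace ℝ (Fin n) →L[ℝ] ℝ)
    (v w : EuclideanSpace ℝ (Fin n)) :
    b v w = ∑ i, ∑ j, v i * b (EuclideanSpace.single i 1) (EuclideanSpace.single j 1) * w j := by
  have h : ∀ v : EuclideanSpace ℝ (Fin n),
      v = ∑ i, v i • EuclideanSpace.single i (1 : ℝ) := fun v => by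
    conv_lhs => rw [← (EuclideanSpace.basisFun (Fin n) ℝ).sum_repr v]
    simp
  conv_lhs => rw [h v, h w]
  simp only [map_sum, map_smul, sum_apply, smul_apply, smul_eq_mul, Finset.mul_sum]
  rw [Finset.sum_comm]
  refine Finset.sum_congr rfl fun i _ => Finset.sum_congr rfl fun j _ => ?_
  ring

/-- The bilinear form on Euclidean space with a given matrix. -/
def bilinOfMatrix (S : Matrix (Fin n) (Fin n) ℝ) :
    EuclideanSpace ℝ (Fin n) →L[ℝ] EuclideanSpace ℝ (Fin n) →L[ℝ] ℝ :=
  ∑ i, ∑ j, S i j • (ContinuousLinearMap.smulRightL ℝ _ _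
    (EuclideanSpace.proj i : EuclideanSpace ℝ (Fin n) →L[ℝ] ℝ)
    (EuclideanSpace.proj j : EuclideanSpace ℝ (Fin n) →L[ℝ] ℝ))

lemma bilinOfMatrix_apply (S : Matrix (Fin n) (Fin n) ℝ) (v w : EuclideanSpace ℝ (Fin n)) :
    bilinOfMatrix S v w = ∑ i, ∑ j, S i j * (v i * w j) := by
  simp [bilinOfMatrix]

lemma bilinOfMatrix_single (S : Matrix (Fin n) (Fin n) ℝ) (i j : Fin n) :
    bilinOfMatrix S (EuclideanSpace.single i 1) (EuclideanSpace.single j 1) = S i j := by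
  rw [bilinOfMatrix_apply, Finset.sum_eq_single i, Finset.sum_eq_single j] <;>
    simp +contextual

lemma bilinOfMatrix_eq_dotProduct (S : Matrix (Fin n) (Fin n) ℝ)
    (v w : EuclideanSpace ℝ (Fin n)) :
    bilinOfMatrix S v w = v.ofLp ⬝ᵥ S.mulVec w.ofLp := by
  rw [bilinOfMatrix_apply]
  simp only [dotProduct, Matrix.mulVec, Finset.mul_sum]
  refine Finset.sum_congr rfl fun i _ => Finset.sum_congr rfl fun j _ => ?_
  ring

lemma bilin_eq_bilinOfMatrix
    (b : EuclideanSpace ℝ (Fin n) →L[ℝ] EuclideanSpace ℝ (Fin n) →L[ℝ] ℝ)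
    (v w : EuclideanSpace ℝ (Fin n)) :
    b v w = bilinOfMatrix (Matrix.of fun i j =>
      b (EuclideanSpace.single i 1) (EuclideanSpace.single j 1)) v w := by
  rw [bilin_apply_eq_sum, bilinOfMatrix_apply]
  refine Finset.sum_congr rfl fun i _ => Finset.sum_congr rfl fun j _ => ?_
  simp only [Matrix.of_apply]
  ring

lemma posDef_of_bilin {b : EuclideanSpace ℝ (Fin n) →L[ℝ] EuclideanSpace ℝ (Fin n) →L[ℝ] ℝ}
    (hs : ∀ v w, b v w = b w v) (hp : ∀ v, v ≠ 0 → 0 < b v v) :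
    (Matrix.of fun i j => b (EuclideanSpace.single i 1) (EuclideanSpace.single j 1)).PosDef := by
  refine Matrix.PosDef.of_dotProduct_mulVec_pos ?_ fun x hx => ?_
  · ext i j
    simp [hs]
  · have h1 := hp (WithLp.toLp 2 x) (by simpa using hx)
    rw [bilin_eq_bilinOfMatrix, bilinOfMatrix_eq_dotProduct] at h1
    simpa using h1

/-- A positive definite continuous bilinear form on Euclidean space has a bounded unit ball. -/
lemma isVonNBounded_of_pos
    {b : EuclideanSpace ℝ (Fin n) →L[ℝ] EuclideanSpace ℝ (Fin n) →L[ℝ] ℝ}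
    (hp : ∀ v, v ≠ 0 → 0 < b v v) : Bornology.IsVonNBounded ℝ {v | b v v < 1} := by
  have hc : Continuous fun v => b v v := by fun_prop
  obtain ⟨m, hm, hb⟩ := (isCompact_sphere (0 : EuclideanSpace ℝ (Fin n)) 1).exists_forall_le'
    hc.continuousOn (a := 0) fun v hv => hp v (by
      rintro rfl
      simp at hv)
  rw [NormedSpace.isVonNBounded_iff]
  refine (Metric.isBounded_iff_subset_closedBall 0).2 ⟨√m⁻¹, fun v hv => ?_⟩
  rw [mem_closedBall_zero_iff]
  rcases eq_or_ne v 0 with rfl | h0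
  · simp
  have hn : 0 < ‖v‖ := norm_pos_iff.2 h0
  have h1 := hb (‖v‖⁻¹ • v) (by simp [norm_smul, hn.ne'])
  simp only [map_smul, smul_apply, smul_eq_mul] at h1
  have hv : b v v < 1 := hv
  refine Real.le_sqrt_of_sq_le ?_
  rw [← mul_assoc, ← mul_inv, inv_mul_eq_div, le_div_iff₀ (by positivity)] at h1
  rw [inv_eq_one_div, le_div_iff₀ hm]
  nlinarith

end Bilinear

/-! ### Chart frames of the tangent bundle -/

section Frames

variable {n : ℕ} {M : Type*} [TopologicalSpace M] [ChartedSpace (EuclideanSpace ℝ (Fin n)) M]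
  [IsManifold (𝓡 n) ∞ M]

lemma gramAt_posDef (g : RiemMetric n M) (p : M) : (gramAt g p).PosDef :=
  posDef_of_bilin (b := g.inner p) (g.symm p) (g.pos p)

lemma RiemMetric.ext_gramAt {g h : RiemMetric n M} (H : ∀ p, gramAt g p = gramAt h p) : g = h := by
  have : g.inner = h.inner := by
    funext p
    refine ContinuousLinearMap.ext fun v => ContinuousLinearMap.ext fun w => ?_
    have e1 := bilin_eq_bilinOfMatrix (g.inner p) v w
    have e2 := bilin_eq_bilinOfMatrix (h.inner p) v w
    exact e1.trans ((congrArg (fun S => bilinOfMatrix S v w) (H p)).trans e2.symm)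
  cases g
  cases h
  congr

/-- The frame of the tangent bundle given by its trivialization around `c`, as a linear map from
the model space to the tangent space at `p`. -/
def frame (n : ℕ) {M : Type*} [TopologicalSpace M] [ChartedSpace (EuclideanSpace ℝ (Fin n)) M]
    [IsManifold (𝓡 n) ∞ M] (c p : M) :
    EuclideanSpace ℝ (Fin n) →L[ℝ] TangentSpace (𝓡 n) p :=
  (trivializationAt (EuclideanSpace ℝ (Fin n)) (TangentSpace (𝓡 n)) c).symmL ℝ p

/-- The Gram matrix at `p` in the frame given by the chart around `c`. -/
def gramFrame (g : RiemMetric n M) (c p : M) : Matrix (Fin n) (Fin n) ℝ :=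
  Matrix.of fun i j => g.inner p (frame n c p (EuclideanSpace.single i 1))
    (frame n c p (EuclideanSpace.single j 1))

/-- The matrix of the frame at `p` in the canonical basis of the tangent space. -/
def frameMatrix (n : ℕ) {M : Type*} [TopologicalSpace M]
    [ChartedSpace (EuclideanSpace ℝ (Fin n)) M] [IsManifold (𝓡 n) ∞ M] (c p : M) :
    Matrix (Fin n) (Fin n) ℝ :=
  Matrix.of fun i j =>
    (show EuclideanSpace ℝ (Fin n) from frame n c p (EuclideanSpace.single j 1)) i

/-- The basis used by `gramAt` comes from the preferred chart at `p` and may jump with `p`; the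
frame of a fixed chart does not. The two Gram matrices are congruent, which `matrixDist` does not
see. -/
lemma gramFrame_eq (g : RiemMetric n M) (c p : M) :
    gramFrame g c p = (frameMatrix n c p).transpose * gramAt g p * frameMatrix n c p := by
  ext i j
  have := bilin_apply_eq_sum (g.inner p) (frame n c p (EuclideanSpace.single i 1))
    (frame n c p (EuclideanSpace.single j 1))
  refine this.trans ?_
  simp only [Matrix.mul_apply, Finset.sum_mul]
  rw [Finset.sum_comm]
  rfl

lemma isUnit_det_frameMatrix {c p : M}
    (hp : p ∈ (chartAt (EuclideanSpace ℝ (Fin n)) c).source) :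
    IsUnit (frameMatrix n c p).det := by
  rw [← Matrix.isUnit_iff_isUnit_det, ← Matrix.mulVec_injective_iff_isUnit]
  have hp' : p ∈ (trivializationAt (EuclideanSpace ℝ (Fin n)) (TangentSpace (𝓡 n)) c).baseSet := hp
  have hinj : Function.Injective (frame n c p) := by
    intro v w h
    have := congrArg ((trivializationAt (EuclideanSpace ℝ (Fin n))
      (TangentSpace (𝓡 n)) c).continuousLinearMapAt ℝ p) h
    simpa only [frame, Bundle.Trivialization.continuousLinearMapAt_symmL _ hp'] using this
  have key : ∀ v : EuclideanSpace ℝ (Fin n), (frameMatrix n c p).mulVec v.ofLp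
      = (show EuclideanSpace ℝ (Fin n) from frame n c p v).ofLp := by
    intro v
    set L : EuclideanSpace ℝ (Fin n) →L[ℝ] EuclideanSpace ℝ (Fin n) := frame n c p with hL
    have h : v = ∑ i, v i • EuclideanSpace.single i (1 : ℝ) := by
      conv_lhs => rw [← (EuclideanSpace.basisFun (Fin n) ℝ).sum_repr v]
      simp
    ext i
    have e : L v = ∑ j, v j • L (EuclideanSpace.single j 1) := by
      conv_lhs => rw [h]
      simp only [map_sum, map_smul]
    change ∑ j, L (EuclideanSpace.single j 1) i * v j = L v i
    rw [e]
    simp [mul_comm]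
  intro x y hxy
  have := (key (WithLp.toLp 2 x)).symm.trans (hxy.trans (key (WithLp.toLp 2 y)))
  have h2 := hinj ((WithLp.ofLp_injective 2) this)
  simpa using h2

lemma gramFrame_posDef (g : RiemMetric n M) {c p : M}
    (hp : p ∈ (chartAt (EuclideanSpace ℝ (Fin n)) c).source) : (gramFrame g c p).PosDef := by
  rw [gramFrame_eq]
  exact posDef_congr (gramAt_posDef g p) (isUnit_det_frameMatrix hp)

lemma fiberDist_eq_gramFrame (g₀ g h : RiemMetric n M) {c p : M}
    (hp : p ∈ (chartAt (EuclideanSpace ℝ (Fin n)) c).source) :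
    fiberDist g₀ p g h = matrixDist (gramFrame g₀ c p) (gramFrame g c p) (gramFrame h c p) := by
  rw [gramFrame_eq, gramFrame_eq, gramFrame_eq,
    matrixDist_congr (gramAt_posDef g p) (gramAt_posDef h p) (isUnit_det_frameMatrix hp)]
  rfl

lemma continuousOn_gramFrame (g : RiemMetric n M) (c : M) :
    ContinuousOn (gramFrame g c) (chartAt (EuclideanSpace ℝ (Fin n)) c).source := by
  set e := trivializationAt (EuclideanSpace ℝ (Fin n)) (TangentSpace (𝓡 n) (M := M)) c
  have hv : ∀ v : EuclideanSpace ℝ (Fin n), ContMDiffOn (𝓡 n) ((𝓡 n).prod (𝓡 n)) ∞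
      (fun p => Bundle.TotalSpace.mk' (EuclideanSpace ℝ (Fin n)) p (frame n c p v)) e.baseSet := by
    intro v
    rw [e.contMDiffOn_section_baseSet_iff]
    refine (contMDiffOn_const (c := v)).congr fun p hp => ?_
    have := e.apply_mk_symm hp v
    simp only [frame]
    rw [Bundle.Trivialization.symmL_apply _ hp, this]
  refine continuousOn_pi.2 fun i => continuousOn_pi.2 fun j => ?_
  have h : ContMDiffOn (𝓡 n) ((𝓡 n).prod 𝓘(ℝ)) ∞
      (fun p => Bundle.TotalSpace.mk' ℝ (E := Bundle.Trivial M ℝ) p (gramFrame g c p i j))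
      e.baseSet := by
    apply ContMDiffOn.clm_bundle_apply₂ (F₁ := EuclideanSpace ℝ (Fin n))
      (F₂ := EuclideanSpace ℝ (Fin n)) (E₁ := TangentSpace (𝓡 n)) (E₂ := TangentSpace (𝓡 n))
      (ψ := g.inner)
    · exact g.contMDiff.contMDiffOn
    · exact hv _
    · exact hv _
  intro p hp
  have h2 := h p hp
  simp only [Bundle.contMDiffWithinAt_totalSpace] at h2
  exact h2.2.continuousWithinAt

lemma gramInChart_eq (g : RiemMetric n M) (c : M) {x : EuclideanSpace ℝ (Fin n)}
    (hx : x ∈ (chartAt (EuclideanSpace ℝ (Fin n)) c).target) :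
    gramInChart g (chartAt (EuclideanSpace ℝ (Fin n)) c) x
      = gramFrame g c ((chartAt (EuclideanSpace ℝ (Fin n)) c).symm x) := by
  set e := chartAt (EuclideanSpace ℝ (Fin n)) c
  have h := TangentBundle.symmL_trivializationAt (I := 𝓡 n) (x₀ := c) (e.map_target hx)
  have h1 : frame n c (e.symm x) = mfderiv (𝓡 n) (𝓡 n) e.symm x := by
    have hx' : (chartAt (EuclideanSpace ℝ (Fin n)) c)
        ((chartAt (EuclideanSpace ℝ (Fin n)) c).symm x) = x := e.right_inv hx
    -- The type of the derivative depends on its base point, so the equality is proved for a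
    -- variable point and specialized to `e (e.symm x)`.
    have h2 : ∀ y, y = x → (mfderiv (𝓡 n) (𝓡 n) e.symm y :
        EuclideanSpace ℝ (Fin n) →L[ℝ] EuclideanSpace ℝ (Fin n))
        = mfderiv (𝓡 n) (𝓡 n) e.symm x := by
      rintro y rfl
      rfl
    rw [frame, h]
    simp only [modelWithCornersSelf_coe, range_id, mfderivWithin_univ]
    exact h2 _ hx'
  ext i j
  simp only [gramInChart, gramFrame, Matrix.of_apply, h1]
  rfl

end Frames

/-! ### The Riemannian volume measure -/

section Volume

/-- The measure which vanishes on countable sets and is infinite on the other ones. -/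
def cocountableMeasure (α : Type*) [MeasurableSpace α] : Measure α := by
  classical
  refine Measure.ofMeasurable (fun s _ => if s.Countable then 0 else ⊤) (by simp) ?_
  intro f hf _
  by_cases h : ∀ i, (f i).Countable
  · simp [h, countable_iUnion h]
  · have h' : ¬ (⋃ i, f i).Countable := fun hc => h fun i => hc.mono (subset_iUnion f i)
    push Not at h
    obtain ⟨i, hi⟩ := h
    rw [if_neg h', eq_comm]
    exact ENNReal.tsum_eq_top_of_eq_top ⟨i, if_neg hi⟩

lemma cocountableMeasure_apply {α : Type*} [MeasurableSpace α] {s : Set α}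
    (hs : MeasurableSet s) [Decidable s.Countable] :
    cocountableMeasure α s = if s.Countable then 0 else ⊤ := by
  rw [cocountableMeasure, Measure.ofMeasurable_apply _ hs]
  congr

variable {n : ℕ} {M : Type*} [TopologicalSpace M] [MeasurableSpace M] [BorelSpace M]

lemma aemeasurable_chart_symm (e : OpenPartialHomeomorph M (EuclideanSpace ℝ (Fin n)))
    (f : EuclideanSpace ℝ (Fin n) → ENNReal) :
    AEMeasurable e.symm ((volume.restrict e.target).withDensity f) :=
  (e.continuousOn_symm.aemeasurable e.open_target.measurableSet).mono_ac
    (withDensity_absolutelyContinuous _ _)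

variable [ChartedSpace (EuclideanSpace ℝ (Fin n)) M] [IsManifold (𝓡 n) ∞ M]

lemma chartVolume_apply_of_countable [T2Space M] (hn : n ≠ 0) (g : RiemMetric n M)
    (e : OpenPartialHomeomorph M (EuclideanSpace ℝ (Fin n))) {s : Set M} (hs : s.Countable) :
    chartVolume g e s = 0 := by
  have : Nonempty (Fin n) := Fin.pos_iff_nonempty.1 (Nat.pos_of_ne_zero hn)
  rw [chartVolume, Measure.map_apply_of_aemeasurable (aemeasurable_chart_symm e _)
    hs.measurableSet]
  refine withDensity_absolutelyContinuous _ _ ?_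
  rw [Measure.restrict_apply' e.open_target.measurableSet]
  refine Set.Countable.measure_zero ?_ _
  refine MapsTo.countable_of_injOn (f := e.symm) (t := s) (fun x hx => hx.1) ?_ hs
  exact e.symm.injOn.mono inter_subset_right

/-- A supremum of measures is not evaluated set by set. It is bounded by any common upper bound, and
`cocountableMeasure` is one that vanishes on points. -/
lemma volumeMeasure_singleton [T2Space M] (hn : n ≠ 0) (g : RiemMetric n M) (p : M) :
    volumeMeasure g {p} = 0 := by
  classical
  have h : volumeMeasure g ≤ cocountableMeasure M := by
    refine iSup_le fun q => Measure.le_iff.2 fun s hs => ?_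
    rw [cocountableMeasure_apply hs]
    split_ifs with hc
    · exact (chartVolume_apply_of_countable hn g _ hc).le
    · exact le_top
  refine le_antisymm ((h _).trans_eq ?_) zero_le
  rw [cocountableMeasure_apply (measurableSet_singleton p), if_pos (countable_singleton p)]

/-- The measure of a single chart is a lower bound, and its density is positive on the nonempty open
part of `V` seen in the chart. -/
lemma volumeMeasure_pos (g : RiemMetric n M) {V : Set M} (hV : IsOpen V) (hne : V.Nonempty) :
    0 < volumeMeasure g V := by
  obtain ⟨p, hp⟩ := hne
  set e := chartAt (EuclideanSpace ℝ (Fin n)) p with he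
  refine lt_of_lt_of_le ?_ (le_iSup (fun p : M =>
    chartVolume g (chartAt (EuclideanSpace ℝ (Fin n)) p)) p V)
  rw [chartVolume, Measure.map_apply_of_aemeasurable (aemeasurable_chart_symm e _)
    hV.measurableSet]
  set W := e.target ∩ e.symm ⁻¹' V with hW
  have hWo : IsOpen W := e.symm.isOpen_inter_preimage hV
  have hWne : W.Nonempty := ⟨e p, e.map_source (mem_chart_source _ p), by
    simpa [e.left_inv (mem_chart_source _ p)] using hp⟩
  refine lt_of_lt_of_le ?_ (measure_mono (inter_subset_right : W ⊆ _))
  rw [withDensity_apply _ hWo.measurableSet, Measure.restrict_restrict hWo.measurableSet,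
    inter_eq_self_of_subset_left (inter_subset_left : W ⊆ e.target), pos_iff_ne_zero]
  have hc : ContinuousOn (fun x => ENNReal.ofReal √(gramInChart g e x).det) W := by
    have h1 : ContinuousOn (fun x => gramFrame g p (e.symm x)) W :=
      (continuousOn_gramFrame g p).comp (e.continuousOn_symm.mono inter_subset_left)
        fun x hx => e.map_target hx.1
    have h2 : ContinuousOn (fun x => gramInChart g e x) W :=
      h1.congr fun x hx => gramInChart_eq g p hx.1
    have h3 : Continuous fun A : Matrix (Fin n) (Fin n) ℝ => ENNReal.ofReal √A.det :=
      ENNReal.continuous_ofReal.comp (continuous_id.matrix_det.sqrt)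
    exact h3.comp_continuousOn h2
  rw [Ne, lintegral_eq_zero_iff' (hc.aemeasurable hWo.measurableSet)]
  intro h0
  have h1 : ∀ᵐ x ∂volume.restrict W, x ∉ W := by
    filter_upwards [h0] with x hx hxW
    refine (ENNReal.ofReal_pos.2 (Real.sqrt_pos.2 ?_)).ne' hx
    rw [gramInChart_eq g p hxW.1]
    exact (gramFrame_posDef g (e.map_target hxW.1)).det_pos
  rw [ae_iff, Measure.restrict_apply' hWo.measurableSet] at h1
  refine (hWo.measure_pos volume hWne).ne' (le_antisymm ((measure_mono ?_).trans_eq h1) zero_le)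
  exact fun x hx => ⟨by simpa using hx, hx⟩

end Volume

/-! ### Constructions of Riemannian metrics -/

section Metrics

variable {n : ℕ} {M : Type*} [TopologicalSpace M] [ChartedSpace (EuclideanSpace ℝ (Fin n)) M]
  [IsManifold (𝓡 n) ∞ M]

/-- A smooth symmetric positive definite section of the bundle of bilinear forms, as a metric. -/
def metricOfSection
    (s : ∀ p : M, TangentSpace (𝓡 n) p →L[ℝ] TangentSpace (𝓡 n) p →L[ℝ] ℝ)
    (hsymm : ∀ p v w, s p v w = s p w v) (hpos : ∀ p v, v ≠ 0 → 0 < s p v v)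
    (hs : ContMDiff (𝓡 n) ((𝓡 n).prod
      𝓘(ℝ, EuclideanSpace ℝ (Fin n) →L[ℝ] EuclideanSpace ℝ (Fin n) →L[ℝ] ℝ)) ∞
      (fun p => Bundle.TotalSpace.mk'
        (EuclideanSpace ℝ (Fin n) →L[ℝ] EuclideanSpace ℝ (Fin n) →L[ℝ] ℝ) p (s p))) :
    RiemMetric n M where
  inner := s
  symm := hsymm
  pos := hpos
  isVonNBounded p := isVonNBounded_of_pos (hpos p)
  contMDiff := hs

/-- The convex combination `φ g + (1 - φ) h` of two metrics. -/
def interpolate (φ : M → ℝ) (hφ : ContMDiff (𝓡 n) 𝓘(ℝ) ∞ φ) (h01 : ∀ p, φ p ∈ Icc (0 : ℝ) 1)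
    (g h : RiemMetric n M) : RiemMetric n M :=
  metricOfSection (fun p => φ p • g.inner p + (1 - φ p) • h.inner p)
    (fun p v w => by
      simp only [add_apply, smul_apply, g.symm p v w, h.symm p v w])
    (fun p v hv => by
      have h1 := g.pos p v hv
      have h2 := h.pos p v hv
      simp only [add_apply, smul_apply, smul_eq_mul]
      rcases (h01 p).1.eq_or_lt with h0 | h0
      · rw [← h0]; simpa using h2
      · exact add_pos_of_pos_of_nonneg (mul_pos h0 h1)
          (mul_nonneg (sub_nonneg.2 (h01 p).2) h2.le))
    ((hφ.smul_section g.contMDiff).add_section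
      ((contMDiff_const.sub hφ).smul_section h.contMDiff))

lemma gramFrame_interpolate (φ : M → ℝ) (hφ : ContMDiff (𝓡 n) 𝓘(ℝ) ∞ φ)
    (h01 : ∀ p, φ p ∈ Icc (0 : ℝ) 1) (g h : RiemMetric n M) (c p : M) :
    gramFrame (interpolate φ hφ h01 g h) c p
      = φ p • gramFrame g c p + (1 - φ p) • gramFrame h c p := by
  ext i j
  rfl

/-- The trivialization around `c` of the tangent bundle, as a linear map from the tangent space
at `p` to the model space. -/
def coframe (n : ℕ) {M : Type*} [TopologicalSpace M] [ChartedSpace (EuclideanSpace ℝ (Fin n)) M]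
    [IsManifold (𝓡 n) ∞ M] (c p : M) :
    EuclideanSpace ℝ (Fin n) →L[ℝ] EuclideanSpace ℝ (Fin n) :=
  (trivializationAt (EuclideanSpace ℝ (Fin n))
    (TangentSpace (𝓡 n)) c).continuousLinearMapAt ℝ p

/-- The bilinear form on the tangent space at `p` with constant matrix `S` in the frame around
`c`. -/
def constForm (S : Matrix (Fin n) (Fin n) ℝ) (c p : M) :
    TangentSpace (𝓡 n) p →L[ℝ] TangentSpace (𝓡 n) p →L[ℝ] ℝ :=
  show EuclideanSpace ℝ (Fin n) →L[ℝ] EuclideanSpace ℝ (Fin n) →L[ℝ] ℝ from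
    (bilinOfMatrix S).bilinearComp (coframe n c p) (coframe n c p)

-- Read in the trivialization around `c`, the section is the constant `bilinOfMatrix S`.
set_option synthInstance.maxHeartbeats 400000 in
lemma contMDiffOn_constForm (S : Matrix (Fin n) (Fin n) ℝ) (c : M) :
    ContMDiffOn (𝓡 n) ((𝓡 n).prod
      𝓘(ℝ, EuclideanSpace ℝ (Fin n) →L[ℝ] EuclideanSpace ℝ (Fin n) →L[ℝ] ℝ)) ∞
      (fun p => Bundle.TotalSpace.mk'
        (EuclideanSpace ℝ (Fin n) →L[ℝ] EuclideanSpace ℝ (Fin n) →L[ℝ] ℝ) p (constForm S c p))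
      (chartAt (EuclideanSpace ℝ (Fin n)) c).source := by
  have hb : (trivializationAt
      (EuclideanSpace ℝ (Fin n) →L[ℝ] EuclideanSpace ℝ (Fin n) →L[ℝ] ℝ)
      (fun p : M => TangentSpace (𝓡 n) p →L[ℝ] TangentSpace (𝓡 n) p →L[ℝ] ℝ) c).baseSet
      = (chartAt (EuclideanSpace ℝ (Fin n)) c).source := by
    simp [hom_trivializationAt_baseSet]
  rw [← hb, Bundle.Trivialization.contMDiffOn_section_baseSet_iff]
  refine (contMDiffOn_const (c := bilinOfMatrix S)).congr fun p hp => ?_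
  rw [hb] at hp
  ext v w
  have hp' : p ∈ (trivializationAt (EuclideanSpace ℝ (Fin n)) (TangentSpace (𝓡 n)) c).baseSet := hp
  have h1 : ∀ v, coframe n c p (frame n c p v) = v := fun v =>
    Bundle.Trivialization.continuousLinearMapAt_symmL _ hp' v
  rw [hom_trivializationAt_apply]
  have h2 : ∀ φ : TangentSpace (𝓡 n) p →L[ℝ] ℝ,
      (Bundle.Trivialization.continuousLinearMapAt ℝ (trivializationAt
        (EuclideanSpace ℝ (Fin n) →L[ℝ] ℝ) (fun p : M => TangentSpace (𝓡 n) p →L[ℝ] ℝ) c) p φ) w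
      = φ (frame n c p w) := by
    intro φ
    have hp'' : p ∈ (trivializationAt
        (EuclideanSpace ℝ (Fin n) →L[ℝ] ℝ) (fun p : M => TangentSpace (𝓡 n) p →L[ℝ] ℝ) c).baseSet :=
      ⟨hp, mem_univ p⟩
    rw [Bundle.Trivialization.continuousLinearMapAt_apply,
      Bundle.Trivialization.coe_linearMapAt_of_mem _ hp'']
    beta_reduce
    rw [hom_trivializationAt_apply]
    simp only [ContinuousLinearMap.inCoordinates, Bundle.Trivial.fiberBundle_trivializationAt',
      Bundle.Trivial.continuousLinearMapAt_trivialization]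
    rfl
  refine (h2 _).trans ?_
  change bilinOfMatrix S (coframe n c p (frame n c p v)) (coframe n c p (frame n c p w)) = _
  rw [h1, h1]

/-- The form with constant matrix `S` is cut off by a bump function equal to 1 on `K` and supported
in the chart domain, and `g₀` fills up the rest. -/
lemma exists_metric_gramFrame_eq [T2Space M] [SigmaCompactSpace M] [NormalSpace M]
    (g₀ : RiemMetric n M) {c : M} {K : Set M} (hK : IsClosed K)
    (hKc : K ⊆ (chartAt (EuclideanSpace ℝ (Fin n)) c).source) {S : Matrix (Fin n) (Fin n) ℝ}
    (hS : S.PosDef) : ∃ g : RiemMetric n M, ∀ p ∈ K, gramFrame g c p = S := by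
  obtain ⟨ψ, hψ0, hψ1, hψ⟩ := exists_contMDiffMap_zero_one_nhds_of_isClosed (n := ⊤) (𝓡 n)
    (chartAt (EuclideanSpace ℝ (Fin n)) c).open_source.isClosed_compl hK
    (disjoint_compl_left_iff_subset.2 hKc)
  have hsupp : tsupport ψ ⊆ (chartAt (EuclideanSpace ℝ (Fin n)) c).source := by
    intro p hp
    by_contra hpc
    exact notMem_tsupport_iff_eventuallyEq.2 (hψ0.filter_mono (nhds_le_nhdsSet hpc)) hp
  have hcof : ∀ p ∈ (chartAt (EuclideanSpace ℝ (Fin n)) c).source, ∀ v,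
      frame n c p (coframe n c p v) = v := fun p hp v =>
    Bundle.Trivialization.symmL_continuousLinearMapAt (trivializationAt (EuclideanSpace ℝ (Fin n))
      (TangentSpace (𝓡 n)) c) hp v
  have hfco : ∀ p ∈ (chartAt (EuclideanSpace ℝ (Fin n)) c).source, ∀ v,
      coframe n c p (frame n c p v) = v := fun p hp v =>
    Bundle.Trivialization.continuousLinearMapAt_symmL (trivializationAt (EuclideanSpace ℝ (Fin n))
      (TangentSpace (𝓡 n)) c) hp v
  have happ : ∀ p v w, constForm S c p v w = bilinOfMatrix S (coframe n c p v) (coframe n c p w) :=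
    fun _ _ _ => rfl
  refine ⟨metricOfSection (fun p => ψ p • constForm S c p + (1 - ψ p) • g₀.inner p) ?_ ?_ ?_, ?_⟩
  · intro p v w
    have : constForm S c p v w = constForm S c p w v := by
      rw [happ, happ, bilinOfMatrix_apply, bilinOfMatrix_apply, Finset.sum_comm]
      refine Finset.sum_congr rfl fun i _ => Finset.sum_congr rfl fun j _ => ?_
      rw [show S j i = S i j from hS.1.apply i j]
      ring
    simp only [add_apply, smul_apply, g₀.symm p v w, this]
  · intro p v hv
    have h2 := g₀.pos p v hv
    simp only [add_apply, smul_apply, smul_eq_mul]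
    rcases (hψ p).1.eq_or_lt with h0 | h0
    · rw [← h0]; simpa using h2
    · refine add_pos_of_pos_of_nonneg (mul_pos h0 ?_) (mul_nonneg (sub_nonneg.2 (hψ p).2) h2.le)
      have hp : p ∈ (chartAt (EuclideanSpace ℝ (Fin n)) c).source :=
        hsupp (subset_tsupport _ h0.ne')
      rw [happ, bilinOfMatrix_eq_dotProduct]
      refine hS.dotProduct_mulVec_pos fun h => hv ?_
      have h3 : coframe n c p v = 0 := (WithLp.ofLp_injective 2) h
      rw [← hcof p hp v, h3, map_zero]
  · exact (ContMDiffOn.smul_section_of_tsupport ψ.contMDiff.contMDiffOn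
      (chartAt (EuclideanSpace ℝ (Fin n)) c).open_source hsupp
      (contMDiffOn_constForm S c)).add_section
      ((contMDiff_const.sub ψ.contMDiff).smul_section g₀.contMDiff)
  · intro p hp
    have h1 : ψ p = 1 := (hψ1.filter_mono (nhds_le_nhdsSet hp)).self_of_nhds
    ext i j
    change ψ p * constForm S c p (frame n c p (EuclideanSpace.single i 1))
      (frame n c p (EuclideanSpace.single j 1)) + (1 - ψ p) * gramFrame g₀ c p i j = S i j
    rw [happ, hfco p (hKc hp), hfco p (hKc hp), bilinOfMatrix_single, h1]
    ring

end Metrics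

/-! ### Riemannian metrics as square integrable maps -/

section Embedding

variable {n : ℕ} {M : Type*} [TopologicalSpace M] [ChartedSpace (EuclideanSpace ℝ (Fin n)) M]
  [IsManifold (𝓡 n) ∞ M]

lemma congr_cancel {C X Y : Matrix (Fin n) (Fin n) ℝ} (hC : IsUnit C.det)
    (h : C.transpose * X * C = C.transpose * Y * C) : X = Y := by
  have hC1 : IsUnit C := (Matrix.isUnit_iff_isUnit_det C).2 hC
  have hC2 : IsUnit C.transpose := (Matrix.isUnit_iff_isUnit_det _).2 (by rwa [Matrix.det_transpose])
  exact hC2.mul_left_cancel (hC1.mul_right_cancel h)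

/-- The scalar product with matrix `X` in the frame around `c` at `p`, expressed in an orthonormal
frame for `g₀` and considered as a point of `PBar n`. -/
def normalize (g₀ : RiemMetric n M) (c p : M) (X : Matrix (Fin n) (Fin n) ℝ) : PBar n :=
  toPBar ((invSqrt (gramFrame g₀ c p)).transpose * X * invSqrt (gramFrame g₀ c p))

lemma dist_normalize (g₀ : RiemMetric n M) {c p : M}
    (hp : p ∈ (chartAt (EuclideanSpace ℝ (Fin n)) c).source) {X Y : Matrix (Fin n) (Fin n) ℝ}
    (hX : X.PosDef) (hY : Y.PosDef) :
    dist (normalize g₀ c p X) (normalize g₀ c p Y) = matrixDist (gramFrame g₀ c p) X Y := by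
  have h0 := gramFrame_posDef g₀ hp
  have hu := isUnit_det_invSqrt h0
  rw [normalize, normalize, dist_toPBar (posDef_congr hX hu) (posDef_congr hY hu),
    ← matrixDist_congr (G := gramFrame g₀ c p) hX hY hu, invSqrt_transpose_mul_mul h0]

lemma dist_normalize_gramFrame (g₀ g h : RiemMetric n M) {c p : M}
    (hp : p ∈ (chartAt (EuclideanSpace ℝ (Fin n)) c).source) :
    dist (normalize g₀ c p (gramFrame g c p)) (normalize g₀ c p (gramFrame h c p))
      = fiberDist g₀ p g h := by
  rw [dist_normalize g₀ hp (gramFrame_posDef g hp) (gramFrame_posDef h hp),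
    fiberDist_eq_gramFrame g₀ g h hp]

lemma normalize_self (g₀ : RiemMetric n M) {c p : M}
    (hp : p ∈ (chartAt (EuclideanSpace ℝ (Fin n)) c).source) :
    normalize g₀ c p (gramFrame g₀ c p) = toPBar 1 := by
  rw [normalize, invSqrt_transpose_mul_mul (gramFrame_posDef g₀ hp)]

lemma continuousOn_normalize (g₀ : RiemMetric n M) (c : M) :
    ContinuousOn (fun q : M × Matrix (Fin n) (Fin n) ℝ => normalize g₀ c q.1 q.2)
      ((chartAt (EuclideanSpace ℝ (Fin n)) c).source ×ˢ {X | X.PosDef}) := by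
  have hB : ContinuousOn (fun q : M × Matrix (Fin n) (Fin n) ℝ =>
      invSqrt (gramFrame g₀ c q.1))
      ((chartAt (EuclideanSpace ℝ (Fin n)) c).source ×ˢ {X | X.PosDef}) :=
    continuousOn_invSqrt.comp ((continuousOn_gramFrame g₀ c).comp continuousOn_fst
      fun q hq => hq.1) fun q hq => gramFrame_posDef g₀ hq.1
  have hBt : ContinuousOn (fun q : M × Matrix (Fin n) (Fin n) ℝ =>
      (invSqrt (gramFrame g₀ c q.1)).transpose)
      ((chartAt (EuclideanSpace ℝ (Fin n)) c).source ×ˢ {X | X.PosDef}) :=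
    (continuous_id.matrix_transpose).comp_continuousOn hB
  refine continuousOn_toPBar.comp ((hBt.mul continuousOn_snd).mul hB) fun q hq => ?_
  exact posDef_congr hq.2 (isUnit_det_invSqrt (gramFrame_posDef g₀ hq.1))

lemma continuousOn_normalize_gramFrame (g₀ g : RiemMetric n M) (c : M) :
    ContinuousOn (fun p => normalize g₀ c p (gramFrame g c p))
      (chartAt (EuclideanSpace ℝ (Fin n)) c).source :=
  (continuousOn_normalize g₀ c).comp (f := fun p => (p, gramFrame g c p))
    (continuousOn_id.prodMk (continuousOn_gramFrame g c)) fun _ hp => ⟨hp, gramFrame_posDef g hp⟩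

lemma posDef_combination {X Y : Matrix (Fin n) (Fin n) ℝ} (hX : X.PosDef) (hY : Y.PosDef) {t : ℝ}
    (ht : t ∈ Icc (0 : ℝ) 1) : (t • X + (1 - t) • Y).PosDef := by
  rcases ht.1.eq_or_lt with rfl | h0
  · simpa using hY
  · exact (hX.smul h0).add_posSemidef (hY.posSemidef.smul (sub_nonneg.2 ht.2))

/-- The distances between a metric and its interpolations with another one are bounded. -/
lemma exists_fiberDist_interpolate_le [CompactSpace M] [T2Space M] (g₀ g h : RiemMetric n M) :
    ∃ C : ℝ, ∀ (φ : M → ℝ) (hφ : ContMDiff (𝓡 n) 𝓘(ℝ) ∞ φ) (h01 : ∀ p, φ p ∈ Icc (0 : ℝ) 1)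
      (p : M), fiberDist g₀ p (interpolate φ hφ h01 g h) h ≤ C := by
  have key : ∃ C : ℝ, ∀ p ∈ (univ : Set M), ∀ (φ : M → ℝ) (hφ : ContMDiff (𝓡 n) 𝓘(ℝ) ∞ φ)
      (h01 : ∀ p, φ p ∈ Icc (0 : ℝ) 1), fiberDist g₀ p (interpolate φ hφ h01 g h) h ≤ C := by
    refine isCompact_univ.induction_on (p := fun s => ∃ C : ℝ, ∀ p ∈ s, ∀ (φ : M → ℝ)
      (hφ : ContMDiff (𝓡 n) 𝓘(ℝ) ∞ φ) (h01 : ∀ p, φ p ∈ Icc (0 : ℝ) 1),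
      fiberDist g₀ p (interpolate φ hφ h01 g h) h ≤ C) ⟨0, by simp⟩ ?_ ?_ ?_
    · rintro s t hst ⟨C, hC⟩
      exact ⟨C, fun p hp => hC p (hst hp)⟩
    · rintro s t ⟨C, hC⟩ ⟨D, hD⟩
      refine ⟨max C D, fun p hp φ hφ h01 => ?_⟩
      rcases hp with hp | hp
      · exact (hC p hp φ hφ h01).trans (le_max_left _ _)
      · exact (hD p hp φ hφ h01).trans (le_max_right _ _)
    · intro c _
      set U := (chartAt (EuclideanSpace ℝ (Fin n)) c).source with hU
      obtain ⟨K, hK, hKU, hKc⟩ := local_compact_nhds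
        ((chartAt (EuclideanSpace ℝ (Fin n)) c).open_source.mem_nhds (mem_chart_source _ c))
      -- At `p` the interpolation depends on the cutoff only through the number `φ p ∈ [0, 1]`. The
      -- maximum over the compact set `[0, 1] × K` therefore serves all cutoffs at once.
      have hc : ContinuousOn (fun q : ℝ × M => dist
          (normalize g₀ c q.2 (q.1 • gramFrame g c q.2 + (1 - q.1) • gramFrame h c q.2))
          (normalize g₀ c q.2 (gramFrame h c q.2))) (Icc 0 1 ×ˢ K) := by
        have hm : ∀ g : RiemMetric n M, ContinuousOn (fun q : ℝ × M => gramFrame g c q.2)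
            (Icc 0 1 ×ˢ K) := fun g =>
          (continuousOn_gramFrame g c).comp continuousOn_snd fun q hq => hKU hq.2
        refine continuous_dist.comp_continuousOn (ContinuousOn.prodMk ?_ ?_)
        · refine (continuousOn_normalize g₀ c).comp (f := fun q : ℝ × M =>
            (q.2, q.1 • gramFrame g c q.2 + (1 - q.1) • gramFrame h c q.2)) ?_ ?_
          · exact continuousOn_snd.prodMk ((continuousOn_fst.smul (hm g)).add
              ((continuousOn_const.sub continuousOn_fst).smul (hm h)))
          · exact fun q hq => ⟨hKU hq.2, posDef_combination (gramFrame_posDef g (hKU hq.2))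
              (gramFrame_posDef h (hKU hq.2)) hq.1⟩
        · exact (continuousOn_normalize_gramFrame g₀ h c).comp continuousOn_snd
            fun q hq => hKU hq.2
      obtain ⟨C, hC⟩ := (isCompact_Icc.prod hKc).bddAbove_image hc
      refine ⟨K, mem_nhdsWithin_of_mem_nhds hK, C, fun p hp φ hφ h01 => ?_⟩
      rw [← dist_normalize_gramFrame g₀ _ _ (hKU hp), gramFrame_interpolate]
      have hmem : (φ p, p) ∈ Icc (0 : ℝ) 1 ×ˢ K := ⟨h01 p, hp⟩
      have e := hC (mem_image_of_mem _ hmem)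
      dsimp only at e
      exact e
  obtain ⟨C, hC⟩ := key
  exact ⟨C, fun φ hφ h01 p => hC p (mem_univ p) φ hφ h01⟩

lemma exists_fiberDist_le [CompactSpace M] [T2Space M] (g₀ g h : RiemMetric n M) :
    ∃ C : ℝ, ∀ p : M, fiberDist g₀ p g h ≤ C := by
  obtain ⟨C, hC⟩ := exists_fiberDist_interpolate_le g₀ g h
  refine ⟨C, fun p => ?_⟩
  have h1 : ∀ p : M, (fun _ : M => (1 : ℝ)) p ∈ Icc (0 : ℝ) 1 := fun _ => by simp
  refine le_trans (le_of_eq ?_) (hC (fun _ => 1) contMDiff_const h1 p)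
  have hp := mem_chart_source (EuclideanSpace ℝ (Fin n)) p
  rw [fiberDist_eq_gramFrame _ _ _ hp, fiberDist_eq_gramFrame _ _ _ hp, gramFrame_interpolate]
  simp

lemma gramFrame_eq_of_fiberDist_eq_zero (g₀ g h : RiemMetric n M) {c p : M}
    (hp : p ∈ (chartAt (EuclideanSpace ℝ (Fin n)) c).source) (h0 : fiberDist g₀ p g h = 0) :
    gramFrame g c p = gramFrame h c p := by
  have hu := isUnit_det_invSqrt (gramFrame_posDef g₀ hp)
  rw [← dist_normalize_gramFrame g₀ g h hp, normalize, normalize,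
    dist_toPBar (posDef_congr (gramFrame_posDef g hp) hu)
      (posDef_congr (gramFrame_posDef h hp) hu)] at h0
  exact congr_cancel hu (eq_of_matrixDist_one_eq_zero (posDef_congr (gramFrame_posDef g hp) hu)
    (posDef_congr (gramFrame_posDef h hp) hu) h0)

/-- In a chart frame the set where the two metrics differ is open. If nonempty, it would have
positive volume. -/
lemma eq_of_ae_fiberDist_eq_zero [MeasurableSpace M] [BorelSpace M] (g₀ g h : RiemMetric n M)
    (h0 : ∀ᵐ p ∂volumeMeasure g₀, fiberDist g₀ p g h = 0) : g = h := by
  refine RiemMetric.ext_gramAt fun c => ?_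
  have hc := mem_chart_source (EuclideanSpace ℝ (Fin n)) c
  refine congr_cancel (isUnit_det_frameMatrix hc) ?_
  rw [← gramFrame_eq, ← gramFrame_eq]
  by_contra hne
  set U := (chartAt (EuclideanSpace ℝ (Fin n)) c).source with hU
  have hUo : IsOpen U := (chartAt (EuclideanSpace ℝ (Fin n)) c).open_source
  set V := U ∩ {p | gramFrame g c p ≠ gramFrame h c p} with hV
  have hVo : IsOpen V := by
    have := ((continuousOn_gramFrame g c).prodMk (continuousOn_gramFrame h c)).isOpen_inter_preimage
      hUo (isClosed_diagonal (X := Matrix (Fin n) (Fin n) ℝ)).isOpen_compl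
    exact this
  refine (volumeMeasure_pos g₀ hVo ⟨c, hc, hne⟩).ne' (measure_mono_null ?_ h0)
  exact fun p hp h0 => hp.2 (gramFrame_eq_of_fiberDist_eq_zero g₀ g h hp.1 h0)

/-- A countable closed covering subordinate to charts, with a measurable choice of a member of
the covering containing a given point. -/
structure ChartSelection (n : ℕ) (M : Type*) [TopologicalSpace M]
    [ChartedSpace (EuclideanSpace ℝ (Fin n)) M] [MeasurableSpace M] where
  center : ℕ → M
  piece : ℕ → Set M
  index : M → ℕ
  isClosed (i : ℕ) : IsClosed (piece i)
  subset (i : ℕ) : piece i ⊆ (chartAt (EuclideanSpace ℝ (Fin n)) (center i)).source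
  measurable : Measurable index
  mem (p : M) : p ∈ piece (index p)

omit [IsManifold (𝓡 n) ∞ M] in
lemma nonempty_chartSelection [Nonempty M] [CompactSpace M] [T2Space M] [MeasurableSpace M]
    [BorelSpace M] : Nonempty (ChartSelection n M) := by
  classical
  have h1 : ∀ c : M, ∃ K ∈ nhds c, IsClosed K ∧
      K ⊆ (chartAt (EuclideanSpace ℝ (Fin n)) c).source := fun c => by
    obtain ⟨K, hK, hKU, hKc⟩ := local_compact_nhds
      ((chartAt (EuclideanSpace ℝ (Fin n)) c).open_source.mem_nhds (mem_chart_source _ c))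
    exact ⟨K, hK, hKc.isClosed, hKU⟩
  choose K hK hKc hKs using h1
  obtain ⟨t, ht⟩ := isCompact_univ.elim_nhds_subcover K fun c _ => hK c
  have hcover : ∀ p : M, ∃ c ∈ t, p ∈ K c := fun p => by
    simpa using ht.2 (mem_univ p)
  have htne : (t : Set M).Nonempty := by
    obtain ⟨c, hc, -⟩ := hcover (Classical.arbitrary M)
    exact ⟨c, hc⟩
  obtain ⟨e, he⟩ := t.countable_toSet.exists_eq_range htne
  have hex : ∀ p : M, ∃ i, p ∈ K (e i) := fun p => by
    obtain ⟨c, hc, hp⟩ := hcover p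
    have : c ∈ range e := he ▸ hc
    obtain ⟨i, rfl⟩ := this
    exact ⟨i, hp⟩
  exact ⟨⟨e, fun i => K (e i), fun p => Nat.find (hex p), fun i => hKc _, fun i => hKs _,
    measurable_find hex fun i => (hKc _).measurableSet, fun p => Nat.find_spec (hex p)⟩⟩

variable [MeasurableSpace M]

omit [IsManifold (𝓡 n) ∞ M] in
lemma ChartSelection.mem_source (s : ChartSelection n M) (p : M) :
    p ∈ (chartAt (EuclideanSpace ℝ (Fin n)) (s.center (s.index p))).source :=
  s.subset _ (s.mem p)

/-- A Riemannian metric as a map to `PBar n`. -/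
def toMap (s : ChartSelection n M) (g₀ g : RiemMetric n M) (p : M) : PBar n :=
  normalize g₀ (s.center (s.index p)) p (gramFrame g (s.center (s.index p)) p)

lemma dist_toMap (s : ChartSelection n M) (g₀ g h : RiemMetric n M) (p : M) :
    dist (toMap s g₀ g p) (toMap s g₀ h p) = fiberDist g₀ p g h :=
  dist_normalize_gramFrame g₀ g h (s.mem_source p)

lemma toMap_self (s : ChartSelection n M) (g₀ : RiemMetric n M) (p : M) :
    toMap s g₀ g₀ p = toPBar 1 :=
  normalize_self g₀ (s.mem_source p)

/-- On each level set of the index the frame is that of one chart, and the map is continuous there.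
-/
lemma aestronglyMeasurable_toMap [BorelSpace M] [SecondCountableTopology M]
    (s : ChartSelection n M) (g₀ g : RiemMetric n M) (μ : Measure M) :
    AEStronglyMeasurable (toMap s g₀ g) μ := by
  have hcov : (⋃ i, s.index ⁻¹' {i}) = univ := by
    ext p
    simp
  rw [← Measure.restrict_univ (μ := μ), ← hcov, aestronglyMeasurable_iUnion_iff]
  intro i
  have hm : MeasurableSet (s.index ⁻¹' {i}) := s.measurable (measurableSet_singleton i)
  have hsub : s.index ⁻¹' {i} ⊆ (chartAt (EuclideanSpace ℝ (Fin n)) (s.center i)).source := by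
    rintro p rfl
    exact s.mem_source p
  refine (((continuousOn_normalize_gramFrame g₀ g (s.center i)).mono hsub).aestronglyMeasurable
    hm).congr ?_
  filter_upwards [ae_restrict_mem hm] with p hp
  have hp : s.index p = i := hp
  rw [toMap, hp]

variable [CompactSpace M] [T2Space M] [BorelSpace M] [SecondCountableTopology M]

lemma memLp_fiberDist (g₀ g h : RiemMetric n M) (s : ChartSelection n M)
    [IsFiniteMeasure (volumeMeasure g₀)] :
    MemLp (fun p => fiberDist g₀ p g h) 2 (volumeMeasure g₀) := by
  obtain ⟨C, hC⟩ := exists_fiberDist_le g₀ g h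
  have hm : AEStronglyMeasurable (fun p => fiberDist g₀ p g h) (volumeMeasure g₀) := by
    simp only [← dist_toMap s]
    exact (aestronglyMeasurable_toMap s g₀ g _).dist (aestronglyMeasurable_toMap s g₀ h _)
  refine MemLp.of_bound hm C (Filter.Eventually.of_forall fun p => ?_)
  rw [Real.norm_of_nonneg (show 0 ≤ fiberDist g₀ p g h from matrixDist_nonneg)]
  exact hC p

/-- A Riemannian metric as an element of `L²(M, PBar n)`. -/
def toL2 (s : ChartSelection n M) (g₀ : RiemMetric n M) [IsFiniteMeasure (volumeMeasure g₀)]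
    (g : RiemMetric n M) : L2Map (volumeMeasure g₀) (PBar n) :=
  L2Map.mk (toMap s g₀ g) (aestronglyMeasurable_toMap s g₀ g _) (toPBar 1) (by
    -- The constant `toPBar 1` is the image of `g₀`, so the distance to it is a fibre distance
    -- between two metrics, which is bounded.
    refine (memLp_fiberDist g₀ g g₀ s).congr_norm ?_ (Filter.Eventually.of_forall fun p => ?_)
    · exact (aestronglyMeasurable_toMap s g₀ g _).dist aestronglyMeasurable_const
    · rw [← dist_toMap s, toMap_self])

lemma coeFn_toL2 (s : ChartSelection n M) (g₀ : RiemMetric n M)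
    [IsFiniteMeasure (volumeMeasure g₀)] (g : RiemMetric n M) :
    (toL2 s g₀ g).1 =ᵐ[volumeMeasure g₀] toMap s g₀ g :=
  L2Map.coeFn_mk _ _ _ _

lemma dist_toL2 (s : ChartSelection n M) (g₀ : RiemMetric n M)
    [IsFiniteMeasure (volumeMeasure g₀)] (g h : RiemMetric n M) :
    dist (toL2 s g₀ g) (toL2 s g₀ h) = L2Dist g₀ g h := by
  change √(∫ p, dist ((toL2 s g₀ g).1 p) ((toL2 s g₀ h).1 p) ^ 2 ∂volumeMeasure g₀) = _
  rw [L2Dist]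
  congr 1
  refine integral_congr_ae ?_
  filter_upwards [coeFn_toL2 s g₀ g, coeFn_toL2 s g₀ h] with p h1 h2
  rw [h1, h2, dist_toMap]

lemma toL2_injective (s : ChartSelection n M) (g₀ : RiemMetric n M)
    [IsFiniteMeasure (volumeMeasure g₀)] : Function.Injective (toL2 s g₀) := by
  intro g h hgh
  refine eq_of_ae_fiberDist_eq_zero g₀ g h ?_
  filter_upwards [coeFn_toL2 s g₀ g, coeFn_toL2 s g₀ h] with p h1 h2
  rw [← dist_toMap s, ← h1, ← h2, hgh, dist_self]

end Embedding

/-! ### Density of the Riemannian metrics -/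

section Density

open Filter Topology

lemma edist_sq_le {X : Type*} [PseudoEMetricSpace X] (x y z : X) :
    edist x z ^ 2 ≤ 4 * (edist x y ^ 2 + edist y z ^ 2) := by
  have h : edist x z ≤ 2 * max (edist x y) (edist y z) := by
    rw [two_mul]
    exact (edist_triangle x y z).trans (add_le_add (le_max_left _ _) (le_max_right _ _))
  calc edist x z ^ 2 ≤ (2 * max (edist x y) (edist y z)) ^ 2 := by gcongr
    _ = 4 * (max (edist x y) (edist y z)) ^ 2 := by rw [mul_pow]; norm_num
    _ ≤ _ := by
      gcongr
      rcases max_cases (edist x y) (edist y z) with h | h <;> rw [h.1]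
      · exact le_self_add
      · exact le_add_self

variable {n : ℕ} {M : Type*} [TopologicalSpace M] [ChartedSpace (EuclideanSpace ℝ (Fin n)) M]
  [IsManifold (𝓡 n) ∞ M] [MeasurableSpace M]

/-- A map to `PBar n` that can be approximated by Riemannian metrics in the mean square. -/
def IsApproximable (s : ChartSelection n M) (g₀ : RiemMetric n M) (f : M → PBar n) : Prop :=
  ∀ ε : ENNReal, ε ≠ 0 → ∃ g : RiemMetric n M,
    ∫⁻ p, edist (f p) (toMap s g₀ g p) ^ 2 ∂volumeMeasure g₀ ≤ ε

lemma isApproximable_toMap (s : ChartSelection n M) (g₀ g : RiemMetric n M) :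
    IsApproximable s g₀ (toMap s g₀ g) :=
  fun ε _ => ⟨g, by simp⟩

variable [CompactSpace M] [T2Space M] [BorelSpace M] [SecondCountableTopology M]

/-- By regularity `A` lies between a closed and an open set of nearly the same measure; a smooth
Urysohn function separates the closed set from the complement of the open one. -/
lemma exists_cutoff (μ : Measure M) [IsFiniteMeasure μ] {A : Set M} (hA : MeasurableSet A)
    {η : ENNReal} (hη : η ≠ 0) : ∃ (φ : M → ℝ) (B : Set M), ContMDiff (𝓡 n) 𝓘(ℝ) ∞ φ ∧
      (∀ p, φ p ∈ Icc (0 : ℝ) 1) ∧ MeasurableSet B ∧ μ B ≤ η ∧ (∀ p ∉ B, p ∈ A → φ p = 1) ∧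
      ∀ p ∉ B, p ∉ A → φ p = 0 := by
  have := Manifold.metrizableSpace (𝓡 n) M
  let := TopologicalSpace.metrizableSpaceMetric M
  have h2 : η / 2 ≠ 0 := (ENNReal.half_pos hη).ne'
  obtain ⟨U, hAU, hU, -, hUm⟩ := hA.exists_isOpen_sdiff_lt (μ := μ) (measure_ne_top _ _) h2
  obtain ⟨K, hKA, hK, hKm⟩ := hA.exists_isClosed_sdiff_lt (μ := μ) (measure_ne_top _ _) h2
  obtain ⟨φ, h0, h1, hφ⟩ := exists_contMDiffMap_zero_one_of_isClosed (n := ⊤) (𝓡 n)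
    hU.isClosed_compl hK (disjoint_compl_left_iff_subset.2 (hKA.trans hAU))
  refine ⟨φ, (U \ A) ∪ (A \ K), φ.contMDiff, hφ,
    (hU.measurableSet.diff hA).union (hA.diff hK.measurableSet), ?_, ?_, ?_⟩
  · exact (measure_union_le _ _).trans ((add_le_add hUm.le hKm.le).trans_eq (ENNReal.add_halves η))
  · intro p hp hpA
    refine h1 ?_
    by_contra hpK
    exact hp (Or.inr ⟨hpA, hpK⟩)
  · intro p hp hpA
    refine h0 fun hpU => hp (Or.inl ⟨hpU, hpA⟩)

-- Interpolating the two approximating metrics by a cutoff for `A` gives the right value off a set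
-- `B` of small measure. On `B` the error is bounded independently of the cutoff.
open Classical in
lemma IsApproximable.piecewise {s : ChartSelection n M} {g₀ : RiemMetric n M}
    [IsFiniteMeasure (volumeMeasure g₀)] {f₁ f₂ : M → PBar n} (h₁ : IsApproximable s g₀ f₁)
    (h₂ : IsApproximable s g₀ f₂) {A : Set M} (hA : MeasurableSet A) :
    IsApproximable s g₀ (A.piecewise f₁ f₂) := by
  intro ε hε
  have hε2 : ε / 2 ≠ 0 := (ENNReal.half_pos hε).ne'
  have hδ : ε / 2 / 8 ≠ 0 := ENNReal.div_ne_zero.2 ⟨hε2, by norm_num⟩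
  obtain ⟨g₁, hg₁⟩ := h₁ _ hδ
  obtain ⟨g₂, hg₂⟩ := h₂ _ hδ
  obtain ⟨C, hC⟩ := exists_fiberDist_interpolate_le g₀ g₁ g₂
  obtain ⟨C', hC'⟩ := exists_fiberDist_le g₀ g₁ g₂
  -- `D` bounds the distance from the interpolation to either metric, to `g₁` by way of `g₂`. It is
  -- fixed before the cutoff, so `B` can be chosen small in terms of `D`. If `D = 0` the prescribed
  -- bound on the measure of `B` is infinite, which is harmless.
  set D : ENNReal := ENNReal.ofReal (|C| + |C'|) with hD
  have hη : ε / 2 / (4 * D ^ 2) ≠ 0 := ENNReal.div_ne_zero.2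
    ⟨hε2, ENNReal.mul_ne_top (by norm_num) (ENNReal.pow_ne_top ENNReal.ofReal_ne_top)⟩
  obtain ⟨φ, B, hφ, h01, hB, hBm, hφ1, hφ0⟩ :=
    exists_cutoff (n := n) (volumeMeasure g₀) hA hη
  set g := interpolate φ hφ h01 g₁ g₂ with hg
  refine ⟨g, ?_⟩
  have hgram : ∀ c p, gramFrame g c p = φ p • gramFrame g₁ c p + (1 - φ p) • gramFrame g₂ c p :=
    gramFrame_interpolate φ hφ h01 g₁ g₂
  have hed : ∀ g h : RiemMetric n M, ∀ p, edist (toMap s g₀ g p) (toMap s g₀ h p)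
      = ENNReal.ofReal (fiberDist g₀ p g h) := fun g h p => by rw [edist_dist, dist_toMap]
  have hglue : ∀ p, edist (A.piecewise (toMap s g₀ g₁) (toMap s g₀ g₂) p) (toMap s g₀ g p) ^ 2
      ≤ B.indicator (fun _ => D ^ 2) p := by
    intro p
    by_cases hp : p ∈ B
    · rw [indicator_of_mem hp]
      gcongr
      by_cases hpA : p ∈ A
      · rw [piecewise_eq_of_mem _ _ _ hpA, hed]
        refine ENNReal.ofReal_le_ofReal ?_
        rw [← dist_toMap s]
        refine (dist_triangle _ (toMap s g₀ g₂ p) _).trans ?_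
        rw [dist_toMap, dist_comm, dist_toMap, add_comm]
        exact add_le_add ((hC φ hφ h01 p).trans (le_abs_self _)) ((hC' p).trans (le_abs_self _))
      · rw [piecewise_eq_of_notMem _ _ _ hpA, edist_comm, hed]
        refine ENNReal.ofReal_le_ofReal ?_
        exact ((hC φ hφ h01 p).trans (le_abs_self _)).trans
          (le_add_of_nonneg_right (abs_nonneg _))
    · rw [indicator_of_notMem hp]
      by_cases hpA : p ∈ A
      · rw [piecewise_eq_of_mem _ _ _ hpA]
        simp [toMap, hgram, hφ1 p hp hpA]
      · rw [piecewise_eq_of_notMem _ _ _ hpA]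
        simp [toMap, hgram, hφ0 p hp hpA]
  have hsplit : ∫⁻ p, edist (A.piecewise f₁ f₂ p)
      (A.piecewise (toMap s g₀ g₁) (toMap s g₀ g₂) p) ^ 2 ∂volumeMeasure g₀
      ≤ ε / 2 / 8 + ε / 2 / 8 := by
    rw [← lintegral_add_compl _ hA]
    refine add_le_add (le_trans ?_ hg₁) (le_trans ?_ hg₂)
    · refine le_trans (le_of_eq ?_) (setLIntegral_le_lintegral A _)
      refine setLIntegral_congr_fun hA fun p hp => ?_
      simp only [piecewise_eq_of_mem _ _ _ hp]
    · refine le_trans (le_of_eq ?_) (setLIntegral_le_lintegral Aᶜ _)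
      refine setLIntegral_congr_fun hA.compl fun p hp => ?_
      simp only [piecewise_eq_of_notMem _ _ _ hp]
  calc ∫⁻ p, edist (A.piecewise f₁ f₂ p) (toMap s g₀ g p) ^ 2 ∂volumeMeasure g₀
      ≤ ∫⁻ p, 4 * (edist (A.piecewise f₁ f₂ p)
        (A.piecewise (toMap s g₀ g₁) (toMap s g₀ g₂) p) ^ 2
          + B.indicator (fun _ => D ^ 2) p) ∂volumeMeasure g₀ := by
        refine lintegral_mono fun p => (edist_sq_le _
          (A.piecewise (toMap s g₀ g₁) (toMap s g₀ g₂) p) _).trans ?_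
        gcongr
        exact hglue p
    _ ≤ 4 * ((ε / 2 / 8 + ε / 2 / 8) + D ^ 2 * (ε / 2 / (4 * D ^ 2))) := by
        rw [lintegral_const_mul' _ _ (by norm_num),
          lintegral_add_right _ (measurable_const.indicator hB), lintegral_indicator_const hB]
        gcongr
    _ = 8 * (ε / 2 / 8) + 4 * D ^ 2 * (ε / 2 / (4 * D ^ 2)) := by ring
    _ ≤ ε / 2 + ε / 2 := add_le_add ENNReal.mul_div_le ENNReal.mul_div_le
    _ = ε := ENNReal.add_halves ε

omit [BorelSpace M] in
/-- There are countably many metrics whose values at every point are dense. -/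
lemma exists_seq_dense_toMap (s : ChartSelection n M) (g₀ : RiemMetric n M) :
    ∃ G : ℕ → RiemMetric n M, ∀ p, DenseRange fun m => toMap s g₀ (G m) p := by
  have : SecondCountableTopology {X : Matrix (Fin n) (Fin n) ℝ // X.PosDef} :=
    TopologicalSpace.Subtype.secondCountableTopology _
  have : Nonempty {X : Matrix (Fin n) (Fin n) ℝ // X.PosDef} := ⟨⟨1, Matrix.PosDef.one⟩⟩
  set d := TopologicalSpace.denseSeq {X : Matrix (Fin n) (Fin n) ℝ // X.PosDef}
  have hd : DenseRange d := TopologicalSpace.denseRange_denseSeq _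
  choose G hG using fun i k : ℕ =>
    exists_metric_gramFrame_eq g₀ (s.isClosed i) (s.subset i) (d k).2
  refine ⟨fun m => G m.unpair.1 m.unpair.2, fun p => ?_⟩
  set i := s.index p with hi
  have h0 := gramFrame_posDef g₀ (s.mem_source p)
  have hu := isUnit_det_invSqrt h0
  set B := invSqrt (gramFrame g₀ (s.center i) p) with hB
  -- The congruence that normalizes the frame at `p` is continuous and surjective on positive
  -- definite matrices, so it carries the dense sequence to a dense one.
  set c : {X : Matrix (Fin n) (Fin n) ℝ // X.PosDef} → {X : Matrix (Fin n) (Fin n) ℝ // X.PosDef} :=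
    fun X => ⟨B.transpose * X.1 * B, posDef_congr X.2 hu⟩ with hc
  have hcc : Continuous c := Continuous.subtype_mk
    ((continuous_const.matrix_mul continuous_subtype_val).matrix_mul continuous_const) _
  have hcs : Function.Surjective c := by
    intro Y
    refine ⟨⟨(B⁻¹).transpose * Y.1 * B⁻¹, posDef_congr Y.2 (Matrix.isUnit_nonsing_inv_det B hu)⟩,
      Subtype.ext ?_⟩
    calc B.transpose * ((B⁻¹).transpose * Y.1 * B⁻¹) * B
        = (B⁻¹ * B).transpose * Y.1 * (B⁻¹ * B) := by
          simp only [Matrix.mul_assoc, Matrix.transpose_mul]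
      _ = Y.1 := by rw [Matrix.nonsing_inv_mul _ hu]; simp
  have hdense := dense_image_toPBar (hcs.denseRange.comp hd hcc)
  refine hdense.mono ?_
  rintro _ ⟨_, ⟨k, rfl⟩, rfl⟩
  refine ⟨Nat.pair i k, ?_⟩
  simp only [Nat.unpair_pair, toMap, ← hi, hG i k p (s.mem p), normalize]
  rfl

/-- Almost every point lies in some set `A' m` on which `f` is `δ`-close to the metric `G m`. Gluing
`G 0, …, G (k - 1)` along these sets, with `g₀` on the remainder `B k`, leaves an error `δ²` plus
the integral over `B k` of the squared distance from `f` to `g₀`. This integral tends to zero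
because the measure of `B k` does. -/
lemma isApproximable_of_lintegral_ne_top {s : ChartSelection n M} {g₀ : RiemMetric n M}
    [IsProbabilityMeasure (volumeMeasure g₀)] {f : M → PBar n}
    (hf : AEStronglyMeasurable f (volumeMeasure g₀))
    (hfi : ∫⁻ p, edist (f p) (toMap s g₀ g₀ p) ^ 2 ∂volumeMeasure g₀ ≠ ⊤) :
    IsApproximable s g₀ f := by
  classical
  intro ε hε
  set μ := volumeMeasure g₀ with hμ
  obtain ⟨G, hG⟩ := exists_seq_dense_toMap s g₀
  have hε8 : ε / 8 ≠ 0 := ENNReal.div_ne_zero.2 ⟨hε, by norm_num⟩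
  have hε16 : ε / 8 / 2 ≠ 0 := (ENNReal.half_pos hε8).ne'
  -- The bound by 1 gives `δ² ≤ δ`, so no square root of `ε` is needed.
  set δ : ENNReal := min 1 (ε / 8 / 2) with hδ
  have hδ0 : 0 < δ := lt_min one_pos (pos_iff_ne_zero.2 hε16)
  have hδsq : δ ^ 2 ≤ ε / 8 / 2 := by
    rw [sq]
    calc δ * δ ≤ 1 * (ε / 8 / 2) := mul_le_mul' (min_le_left _ _) (min_le_right _ _)
      _ = _ := one_mul _
  set A : ℕ → Set M := fun m => {p | edist (f p) (toMap s g₀ (G m) p) < δ} with hA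
  have hAn : ∀ m, NullMeasurableSet (A m) μ := fun m =>
    nullMeasurableSet_lt (hf.edist (aestronglyMeasurable_toMap s g₀ (G m) μ)) aemeasurable_const
  -- The sets `A m` are only null measurable; their measurable hulls agree with them up to null
  -- sets.
  set A' : ℕ → Set M := fun m => toMeasurable μ (A m) with hA'
  have hA'm : ∀ m, MeasurableSet (A' m) := fun m => measurableSet_toMeasurable _ _
  have hAA' : ∀ᵐ p ∂μ, ∀ m, p ∈ A' m ↔ p ∈ A m := ae_all_iff.2 fun m =>
    (hAn m).toMeasurable_ae_eq.mem_iff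
  set F : ℕ → M → PBar n := fun k => Nat.rec (toMap s g₀ g₀)
    (fun m F => (A' m).piecewise (toMap s g₀ (G m)) F) k with hF
  have hF0 : F 0 = toMap s g₀ g₀ := rfl
  have hFs : ∀ k, F (k + 1) = (A' k).piecewise (toMap s g₀ (G k)) (F k) := fun k => rfl
  have hFapp : ∀ k, IsApproximable s g₀ (F k) := by
    intro k
    induction k with
    | zero => exact isApproximable_toMap s g₀ g₀
    | succ k ih => exact (isApproximable_toMap s g₀ (G k)).piecewise ih (hA'm k)
  set B : ℕ → Set M := fun k => ⋂ m < k, (A' m)ᶜ with hB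
  have hBm : ∀ k, MeasurableSet (B k) := fun k =>
    MeasurableSet.iInter fun m => MeasurableSet.iInter fun _ => (hA'm m).compl
  set h : M → ENNReal := fun p => edist (f p) (toMap s g₀ g₀ p) ^ 2 with hh
  have hhm : AEMeasurable h μ := (hf.edist (aestronglyMeasurable_toMap s g₀ g₀ μ)).pow_const 2
  have hFle : ∀ k, ∀ᵐ p ∂μ, edist (f p) (F k p) ^ 2 ≤ δ ^ 2 + (B k).indicator h p := by
    intro k
    filter_upwards [hAA'] with p hp
    induction k with
    | zero => simp [hB, hF0, hh]
    | succ k ih =>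
      rw [hFs]
      by_cases hpk : p ∈ A' k
      · rw [piecewise_eq_of_mem _ _ _ hpk]
        have : edist (f p) (toMap s g₀ (G k) p) < δ := (hp k).1 hpk
        exact le_add_right (by gcongr)
      · rw [piecewise_eq_of_notMem _ _ _ hpk]
        refine ih.trans (add_le_add le_rfl ?_)
        by_cases hpB : p ∈ B k
        · have : p ∈ B (k + 1) := by
            simp only [hB, mem_iInter] at hpB ⊢
            intro m hm
            rcases Nat.lt_succ_iff_lt_or_eq.1 hm with hm | rfl
            · exact hpB m hm
            · exact hpk
          rw [indicator_of_mem hpB, indicator_of_mem this]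
        · rw [indicator_of_notMem hpB]
          exact zero_le
  have hBlim : Tendsto (μ ∘ B) atTop (𝓝 0) := by
    have h1 := tendsto_measure_iInter_atTop (μ := μ) (s := B)
      (fun k => (hBm k).nullMeasurableSet) (fun k l hkl p hp => by
        simp only [hB, mem_iInter] at hp ⊢
        exact fun m hm => hp m (hm.trans_le hkl)) ⟨0, measure_ne_top _ _⟩
    have h2 : μ (⋂ k, B k) = 0 := by
      refine measure_mono_null ?_ hAA'
      intro p hp hall
      obtain ⟨m, hm⟩ := (hG p).exists_mem_open Metric.isOpen_eball
        ⟨f p, Metric.mem_eball_self hδ0⟩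
      have hpm : p ∈ B (m + 1) := mem_iInter.1 hp (m + 1)
      simp only [hB, mem_iInter] at hpm
      refine hpm m m.lt_succ_self ((hall m).2 ?_)
      rw [Metric.mem_eball, edist_comm] at hm
      exact hm
    rwa [h2] at h1
  obtain ⟨k, hk⟩ := ((tendsto_setLIntegral_zero hfi hBlim).eventually
    (gt_mem_nhds (pos_iff_ne_zero.2 hε16))).exists
  obtain ⟨g, hg⟩ := hFapp k _ hε8
  refine ⟨g, ?_⟩
  calc ∫⁻ p, edist (f p) (toMap s g₀ g p) ^ 2 ∂μ
      ≤ ∫⁻ p, 4 * ((δ ^ 2 + (B k).indicator h p) + edist (F k p) (toMap s g₀ g p) ^ 2) ∂μ := by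
        refine lintegral_mono_ae ?_
        filter_upwards [hFle k] with p hp
        refine (edist_sq_le _ (F k p) _).trans ?_
        gcongr
    _ = 4 * ((δ ^ 2 + ∫⁻ p in B k, h p ∂μ) + ∫⁻ p, edist (F k p) (toMap s g₀ g p) ^ 2 ∂μ) := by
        have hadd : AEMeasurable (fun p => δ ^ 2 + (B k).indicator h p) μ :=
          aemeasurable_const.add (hhm.indicator (hBm k))
        rw [lintegral_const_mul' _ _ (by norm_num), lintegral_add_left' hadd,
          lintegral_add_left measurable_const,
          lintegral_const, measure_univ, mul_one, lintegral_indicator (hBm k)]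
    _ ≤ 4 * ((ε / 8 / 2 + ε / 8 / 2) + ε / 8) := by gcongr
    _ = 8 * (ε / 8) := by rw [ENNReal.add_halves]; ring
    _ ≤ ε := ENNReal.mul_div_le

lemma denseRange_toL2 (s : ChartSelection n M) (g₀ : RiemMetric n M)
    [IsProbabilityMeasure (volumeMeasure g₀)] : DenseRange (toL2 s g₀) := by
  refine Metric.denseRange_iff.2 fun f r hr => ?_
  have hsq : ∀ g, Integrable (fun p => dist (f.1 p) ((toL2 s g₀ g).1 p) ^ 2) (volumeMeasure g₀) :=
    fun g => (memLp_dist f (toL2 s g₀ g)).integrable_sq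
  have hed : ∀ g, ∫⁻ p, edist (f.1 p) (toMap s g₀ g p) ^ 2 ∂volumeMeasure g₀
      = ∫⁻ p, ENNReal.ofReal (dist (f.1 p) ((toL2 s g₀ g).1 p) ^ 2) ∂volumeMeasure g₀ := fun g => by
    refine lintegral_congr_ae ?_
    filter_upwards [coeFn_toL2 s g₀ g] with p hp
    rw [hp, ENNReal.ofReal_pow dist_nonneg, edist_dist]
  have hf : IsApproximable s g₀ f.1 := by
    refine isApproximable_of_lintegral_ne_top f.1.aestronglyMeasurable ?_
    rw [hed]
    exact (hsq g₀).lintegral_lt_top.ne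
  obtain ⟨g, hg⟩ := hf (ENNReal.ofReal ((r / 2) ^ 2))
    (ENNReal.ofReal_pos.2 (by positivity)).ne'
  refine ⟨g, ?_⟩
  change √(∫ p, dist (f.1 p) ((toL2 s g₀ g).1 p) ^ 2 ∂volumeMeasure g₀) < r
  rw [integral_eq_lintegral_of_nonneg_ae (Eventually.of_forall fun p => sq_nonneg _)
    (hsq g).aestronglyMeasurable, ← hed]
  have := ENNReal.toReal_mono ENNReal.ofReal_ne_top hg
  rw [ENNReal.toReal_ofReal (by positivity)] at this
  refine (Real.sqrt_le_sqrt this).trans_lt ?_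
  rw [Real.sqrt_sq (by positivity)]
  exact half_lt_self hr

end Density

/-! ### The completion of the space of Riemannian metrics -/

/-- An isometry with dense range into a complete space induces an isometry of the completion. -/
theorem nonempty_completion_isometryEquiv {α β : Type*} [PseudoMetricSpace α] [MetricSpace β]
    [CompleteSpace β] {f : α → β} (hf : Isometry f) (hd : DenseRange f) :
    Nonempty (UniformSpace.Completion α ≃ᵢ β) := by
  have he := hf.completion_extension
  have hs : Function.Surjective (UniformSpace.Completion.extension f) := by
    rw [← range_eq_univ, ← he.isClosedEmbedding.isClosed_range.closure_eq, ← dense_iff_closure_eq]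
    refine Dense.mono ?_ hd
    rintro _ ⟨a, rfl⟩
    exact ⟨a, UniformSpace.Completion.extension_coe hf.uniformContinuous a⟩
  exact ⟨⟨Equiv.ofBijective _ ⟨he.injective, hs⟩, he⟩⟩

instance {Ω : Type*} [MeasurableSpace Ω] (μ : Measure Ω) (X : Type*) [MetricSpace X]
    [Subsingleton X] : Subsingleton (L2Map μ X) := by
  refine ⟨fun f g => Subtype.ext (AEEqFun.ext (Filter.Eventually.of_forall fun p => ?_))⟩
  exact Subsingleton.elim _ _

theorem exists_metricSpace_completion (n : ℕ)
    {M : Type*} [TopologicalSpace M] [ChartedSpace (EuclideanSpace ℝ (Fin n)) M]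
    [IsManifold (𝓡 n) ∞ M] [T2Space M] [CompactSpace M] [MeasurableSpace M] [BorelSpace M]
    (g₀ : RiemMetric n M) (hg₀ : volumeMeasure g₀ univ = 1) :
    (∀ g h : RiemMetric n M,
      Integrable (fun p => fiberDist g₀ p g h ^ 2) (volumeMeasure g₀)) ∧
    ∃ _ : MetricSpace (RiemMetric n M), (∀ g h : RiemMetric n M, dist g h = L2Dist g₀ g h) ∧
      Nonempty (UniformSpace.Completion (RiemMetric n M) ≃ᵢ
        L2Map (volume : Measure unitInterval) (PBar n)) := by
  have hprob : IsProbabilityMeasure (volumeMeasure g₀) := ⟨hg₀⟩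
  have : Nonempty M := (volumeMeasure g₀).nonempty_of_neZero
  have : SecondCountableTopology M :=
    ChartedSpace.secondCountable_of_sigmaCompact (EuclideanSpace ℝ (Fin n)) M
  obtain ⟨s⟩ := nonempty_chartSelection (n := n) (M := M)
  have hiso : Nonempty (L2Map (volumeMeasure g₀) (PBar n) ≃ᵢ
      L2Map (volume : Measure unitInterval) (PBar n)) := by
    -- In dimension zero points carry mass, but `PBar 0` is a single point, and so are both `L²`
    -- spaces.
    rcases eq_or_ne n 0 with rfl | hn
    · have : Nonempty (L2Map (volume : Measure unitInterval) (PBar 0)) :=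
        ⟨L2Map.mk (fun _ => toPBar 1) aestronglyMeasurable_const (toPBar 1) (by simp)⟩
      obtain ⟨y⟩ := this
      exact ⟨⟨⟨fun _ => y, fun _ => toL2 s g₀ g₀, fun _ => Subsingleton.elim _ _,
        fun _ => Subsingleton.elim _ _⟩, isometry_subsingleton⟩⟩
    · have : PolishSpace M := by
        have := Manifold.metrizableSpace (𝓡 n) M
        let := TopologicalSpace.metrizableSpaceMetric M
        infer_instance
      obtain ⟨T, S, hT, hS, hTS, hST⟩ := exists_measurePreserving_unitInterval (volumeMeasure g₀)
        (volumeMeasure_singleton hn g₀)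
      exact ⟨L2Map.isometryEquiv hT hS hTS hST⟩
  obtain ⟨e⟩ := hiso
  -- Pulling the distance back along the injective map `toL2` yields all metric axioms for `L2Dist`
  -- at once.
  refine ⟨fun g h => (memLp_fiberDist g₀ g h s).integrable_sq,
    MetricSpace.induced (toL2 s g₀) (toL2_injective s g₀) inferInstance, dist_toL2 s g₀, ?_⟩
  let := MetricSpace.induced (toL2 s g₀) (toL2_injective s g₀) inferInstance
  have hi : Isometry (toL2 s g₀) := Isometry.of_dist_eq fun _ _ => rfl
  obtain ⟨e'⟩ := nonempty_completion_isometryEquiv hi (denseRange_toL2 s g₀)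
  exact ⟨e'.trans e⟩

end EbinMetric

end

theorem mainTheorem3 (n : ℕ)
    {M : Type*} [TopologicalSpace M] [ChartedSpace (EuclideanSpace ℝ (Fin n)) M]
    [IsManifold (𝓡 n) ∞ M] [T2Space M] [CompactSpace M] [MeasurableSpace M] [BorelSpace M]
    (hM : EbinMetric.IsOrientable n M)
    (g₀ : EbinMetric.RiemMetric n M) (hg₀ : EbinMetric.volumeMeasure g₀ Set.univ = 1)
    {M' : Type*} [TopologicalSpace M'] [ChartedSpace (EuclideanSpace ℝ (Fin n)) M']
    [IsManifold (𝓡 n) ∞ M'] [T2Space M'] [CompactSpace M'] [MeasurableSpace M'] [BorelSpace M']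
    (hM' : EbinMetric.IsOrientable n M')
    (g₀' : EbinMetric.RiemMetric n M') (hg₀' : EbinMetric.volumeMeasure g₀' Set.univ = 1) :
    (∀ g h : EbinMetric.RiemMetric n M, MeasureTheory.Integrable
      (fun p => EbinMetric.fiberDist g₀ p g h ^ 2) (EbinMetric.volumeMeasure g₀)) ∧
    ∃ (_ : MetricSpace (EbinMetric.RiemMetric n M)) (_ : MetricSpace (EbinMetric.RiemMetric n M')),
      (∀ g h : EbinMetric.RiemMetric n M, dist g h = EbinMetric.L2Dist g₀ g h) ∧
      (∀ g h : EbinMetric.RiemMetric n M', dist g h = EbinMetric.L2Dist g₀' g h) ∧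
      Nonempty (UniformSpace.Completion (EbinMetric.RiemMetric n M) ≃ᵢ
        EbinMetric.L2Map (MeasureTheory.volume : MeasureTheory.Measure unitInterval)
          (EbinMetric.PBar n)) ∧
      Nonempty (UniformSpace.Completion (EbinMetric.RiemMetric n M) ≃ᵢ
        UniformSpace.Completion (EbinMetric.RiemMetric n M')) := by
  obtain ⟨hint, m, hd, ⟨e⟩⟩ := EbinMetric.exists_metricSpace_completion n g₀ hg₀
  obtain ⟨-, m', hd', ⟨e'⟩⟩ := EbinMetric.exists_metricSpace_completion n g₀' hg₀'
  exact ⟨hint, m, m', hd, hd', ⟨e⟩, ⟨e.trans e'.symm⟩⟩
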